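/- Let $K$ be a field of characteristic zero, $m\ge 0$ an integer, and $A=K+\sum_{i\ge m}Kx^i\subseteq K[x]$. Let ${\cal D}(A)$ be the ring of $K$-linear differential operators on $A$ (in the sense of Grothendieck), let $h=\partial x\in{\cal D}(A)$ with $\partial=d/dx$, so that $h* x^i=(i+1)x^i$, and let $D=K[h]\subseteq{\cal D}(A)$ with the automorphism $\sigma(h)=h-1$. The skew Laurent polynomial ring $D[x,x^{-1};\sigma]$ (with $xd=\sigma(d)x$) acts on $L=K[x,x^{-1}]$, with $x$ acting by multiplication and $h$ as $\partial x$. Every $f\in{\cal D}(A)$ is the restriction to $A$ of the action of a unique element of $D[x,x^{-1};\sigma]$; in this way ${\cal D}(A)\subset D[x,x^{-1};\sigma]\subset\mathbb{B}:=T^{-1}D[x,x^{-1};\sigma]$, where $T$ is the multiplicative submonoid of $D$ generated by all $h-i$, $i\in\mathbb{Z}$. Hence every $\mathbb{B}$-module is a ${\cal D}(A)$-module by restriction, $L$ is a ${\cal D}(A)$-module with submodule $A$, and $A':=L/A$ is a ${\cal D}(A)$-module. Modules are left modules. A ${\cal D}(A)$-module $M$ is $D$-torsion if every element of $M$ is annihilated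 by a nonzero element of $D$. For a maximal ideal $\mathfrak{p}$ of $D$ put $M_{\mathfrak{p}}=\{v\in M\mid \mathfrak{p}v=0\}$; the module $M$ is weight if $M=\bigoplus_{\mathfrak{p}\in{\rm Max}(D)}M_{\mathfrak{p}}$, and ${\rm Supp}(M)=\{\mathfrak{p}\mid M_{\mathfrak{p}}\ne 0\}$. Similarly a $\mathbb{B}$-module is $T^{-1}D$-torsion if each of its elements is annihilated by a nonzero element of $T^{-1}D$. Let ${\cal O}(h)$ be the $\sigma$-orbit of the maximal ideal $(h)$, and for each $\sigma$-orbit ${\cal O}\neq{\cal O}(h)$ in ${\rm Max}(D)$ fix an element $\mathfrak{p}_{\cal O}\in{\cal O}$. A simple ${\cal D}(A)$-module is $D$-torsion if and only if it is weight, and the following hold. 1. $A$ and $A'$ are non-isomorphic simple $D$-torsion ${\cal D}(A)$-modules. Every simple $T^{-1}D$-torsion $\mathbb{B}$-module is, by restriction, a simple $D$-torsion ${\cal D}(A)$-module, isomorphic neither to $A$ nor to $A'$; two simple $T^{-1}D$-torsion $\mathbb{B}$-modules that are isomorphic over ${\cal D}(A)$ are isomorphic over $\mathbb{B}$; and every simple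 $D$-torsion ${\cal D}(A)$-module is isomorphic to $A$, to $A'$, or to the restriction of a simple $T^{-1}D$-torsion $\mathbb{B}$-module. 2. For each $\sigma$-orbit ${\cal O}\ne{\cal O}(h)$, the ${\cal D}(A)$-module $\mathbb{B}/\mathbb{B}\mathfrak{p}_{\cal O}$ is simple and $D$-torsion, ${\rm Supp}(\mathbb{B}/\mathbb{B}\mathfrak{p}_{\cal O})={\cal O}$, and it is isomorphic neither to $A$ nor to $A'$. For distinct orbits these modules are non-isomorphic. Every simple $D$-torsion ${\cal D}(A)$-module is isomorphic to $A$, to $A'$, or to $\mathbb{B}/\mathbb{B}\mathfrak{p}_{\cal O}$ for some ${\cal O}\neq{\cal O}(h)$. 3. For every simple $D$-torsion ${\cal D}(A)$-module $M$, the set ${\rm Supp}(M)$ is infinite and $\dim_K(M)=\infty$. -/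

import Mathlib

open Polynomial

noncomputable section

namespace CuspD

open scoped LaurentPolynomial
open LaurentPolynomial (T T_add T_zero)

/-! ### Differential operators on a commutative algebra -/

section DiffOps

variable (K : Type*) [CommRing K] (A : Type*) [CommRing A] [Algebra K A]

/-- Grothendieck's filtration: `diffOpsLT K A n` is the space of `K`-linear differential
operators on `A` of order `< n`, i.e. `0` for `n = 0`, and for `n + 1` all `f` whose
commutators `[f, a]` with the multiplications by elements `a` of `A` have order `< n`. -/
def diffOpsLT : ℕ → Submodule K (Module.End K A)
  | 0 => ⊥
  | n + 1 =>
    { carrier := {f | ∀ a : A, f * LinearMap.mulLeft K a - LinearMap.mulLeft K a * f ∈ diffOpsLT n}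
      add_mem' := by
        intro f g hf hg a
        have := add_mem (hf a) (hg a)
        convert this using 1
        noncomm_ring
      zero_mem' := by intro a; simp
      smul_mem' := by
        intro c f hf a
        have := (diffOpsLT n).smul_mem c (hf a)
        simpa [smul_sub] using this }

variable {K A}

theorem mem_diffOpsLT_succ {n : ℕ} {f : Module.End K A} :
    f ∈ diffOpsLT K A (n + 1) ↔
      ∀ a : A, f * LinearMap.mulLeft K a - LinearMap.mulLeft K a * f ∈ diffOpsLT K A n :=
  Iff.rfl

theorem diffOpsLT_mono : Monotone (diffOpsLT K A) := by
  refine monotone_nat_of_le_succ fun n => ?_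
  induction n with
  | zero => exact bot_le
  | succ n ih => exact fun f hf a => ih (hf a)

theorem mulLeft_mem_diffOpsLT (b : A) : LinearMap.mulLeft K b ∈ diffOpsLT K A 1 := by
  intro a
  have : LinearMap.mulLeft K b * LinearMap.mulLeft K a
      - LinearMap.mulLeft K a * LinearMap.mulLeft K b = 0 := by
    ext x; simp [mul_left_comm]
  rw [this]
  exact zero_mem _

theorem mul_mem_diffOpsLT (p q : ℕ) {f g : Module.End K A}
    (hf : f ∈ diffOpsLT K A p) (hg : g ∈ diffOpsLT K A q) : f * g ∈ diffOpsLT K A (p + q) := by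
  induction h : p + q generalizing p q f g with
  | zero =>
    obtain rfl : p = 0 := by omega
    have : f = 0 := by simpa [diffOpsLT] using hf
    simp [this]
  | succ n ih =>
    rcases p with _ | p
    · have : f = 0 := by simpa [diffOpsLT] using hf
      simp [this]
    rcases q with _ | q
    · have : g = 0 := by simpa [diffOpsLT] using hg
      simp [this]
    intro a
    have h1 := ih (p + 1) q hf (hg a) (by omega)
    have h2 := ih p (q + 1) (hf a) hg (by omega)
    convert add_mem h1 h2 using 1
    simp only [mul_sub, sub_mul, mul_assoc]
    abel

variable (K A)

/-- The ring `𝒟(A)` of `K`-linear differential operators on the commutative algebra `A`. -/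
def diffOps : Subalgebra K (Module.End K A) where
  carrier := {f | ∃ n, f ∈ diffOpsLT K A n}
  mul_mem' := by
    rintro f g ⟨p, hf⟩ ⟨q, hg⟩
    exact ⟨p + q, mul_mem_diffOpsLT p q hf hg⟩
  add_mem' := by
    rintro f g ⟨p, hf⟩ ⟨q, hg⟩
    exact ⟨max p q, add_mem (diffOpsLT_mono (le_max_left _ _) hf)
      (diffOpsLT_mono (le_max_right _ _) hg)⟩
  algebraMap_mem' := by
    intro r
    refine ⟨1, ?_⟩
    have : algebraMap K (Module.End K A) r = LinearMap.mulLeft K (algebraMap K A r) := by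
      ext x; simp [Algebra.smul_def]
    rw [this]
    exact mulLeft_mem_diffOpsLT _

instance : Ring (diffOps K A) := Subalgebra.toRing _

end DiffOps

/-! ### Skew Laurent polynomial rings -/

section SkewLaurent

variable {R : Type*} [CommRing R]

/-- An infinite cyclic group acting on `R` through the powers of the automorphism `τ`. -/
def SkewGrp (_τ : RingAut R) : Type := Multiplicative ℤ

instance (τ : RingAut R) : CommGroup (SkewGrp τ) := inferInstanceAs (CommGroup (Multiplicative ℤ))

instance (τ : RingAut R) : MulSemiringAction (SkewGrp τ) R :=
  MulSemiringAction.compHom R (zpowersHom (RingAut R) τ : Multiplicative ℤ →* RingAut R)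

/-- The skew Laurent polynomial ring `R[x, x⁻¹; τ]`, whose elements are the finite sums
`∑ rᵢ xⁱ`, with the multiplication determined by `x r = τ(r) x`. -/
abbrev SkewLaurent (τ : RingAut R) : Type _ := SkewMonoidAlgebra R (SkewGrp τ)

namespace SkewLaurent

/-- The element `xⁿ` of the cyclic group. -/
def xp (τ : RingAut R) (n : ℤ) : SkewGrp τ := (Multiplicative.ofAdd n : Multiplicative ℤ)

/-- The monomial `r xⁿ`. -/
def mono (τ : RingAut R) (n : ℤ) (r : R) : SkewLaurent τ := SkewMonoidAlgebra.single (xp τ n) r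

/-- The inclusion of the coefficient ring, `r ↦ r x⁰`. -/
def const (τ : RingAut R) : R →+* SkewLaurent τ where
  toFun := mono τ 0
  map_one' := rfl
  map_mul' a b := by
    have h : xp τ 0 = 1 := rfl
    simp [mono, h, SkewMonoidAlgebra.single_mul_single]
  map_zero' := by simp [mono]
  map_add' a b := by simp [mono, SkewMonoidAlgebra.single_add]

theorem xp_smul (τ : RingAut R) (n : ℤ) (r : R) : xp τ n • r = (τ ^ n) r := rfl

theorem mono_mul_mono (τ : RingAut R) (i j : ℤ) (a b : R) :
    mono τ i a * mono τ j b = mono τ (i + j) (a * (τ ^ i) b) := by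
  simp only [mono, SkewMonoidAlgebra.single_mul_single, xp_smul]
  rfl

theorem xp_inj {τ : RingAut R} {i j : ℤ} : xp τ i = xp τ j ↔ i = j :=
  Multiplicative.ofAdd.injective.eq_iff

theorem coeff_mono (τ : RingAut R) (i j : ℤ) (a : R) :
    (mono τ i a).coeff (xp τ j) = if i = j then a else 0 := by
  classical
  rw [mono, SkewMonoidAlgebra.coeff_single, Finsupp.single_apply]
  simp only [xp_inj]

theorem induction_mono {τ : RingAut R} {p : SkewLaurent τ → Prop} (f : SkewLaurent τ)
    (zero : p 0) (mono : ∀ n a, p (mono τ n a)) (add : ∀ f g, p f → p g → p (f + g)) : p f :=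
  SkewMonoidAlgebra.induction_on f zero (fun g a => mono (Multiplicative.toAdd g) a) add

theorem ext_xp {τ : RingAut R} {f g : SkewLaurent τ}
    (h : ∀ n, f.coeff (xp τ n) = g.coeff (xp τ n)) : f = g :=
  SkewMonoidAlgebra.ext fun n => h (Multiplicative.toAdd n)

end SkewLaurent
end SkewLaurent

/-! ### The polynomial ring `D = K[h]`, its automorphism `σ`, and the generalized cusp algebra -/

section Cusp

variable (K : Type*) [Field K]

/-- The automorphism `σ` of `D = K[h]` with `σ(h) = h - 1`. -/
def sigma : RingAut K[X] := (algEquivAevalXAddC (-1 : K)).toRingEquiv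

variable {K}

theorem sigma_apply (d : K[X]) : sigma K d = d.comp (X - 1) := by
  simp [sigma, Polynomial.aeval_def, Polynomial.comp, sub_eq_add_neg]

theorem sigma_symm_apply (d : K[X]) : (sigma K)⁻¹ d = d.comp (X + 1) := by
  apply (sigma K).injective
  have : sigma K ((sigma K)⁻¹ d) = d := (sigma K).apply_symm_apply d
  rw [this, sigma_apply, Polynomial.comp_assoc]
  simp

theorem sigma_zpow_apply (n : ℤ) (d : K[X]) : (sigma K ^ n) d = d.comp (X - C (n : K)) := by
  induction n generalizing d with
  | zero => simp
  | succ n ih =>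
    rw [zpow_add_one, RingAut.mul_apply, ih, sigma_apply, Polynomial.comp_assoc]
    congr 1
    simp only [Polynomial.sub_comp, X_comp, Polynomial.one_comp, Int.cast_add, Int.cast_one, C_add,
      C_1]
    ring
  | pred n ih =>
    rw [zpow_sub_one, RingAut.mul_apply, ih, sigma_symm_apply, Polynomial.comp_assoc]
    congr 1
    simp only [Polynomial.add_comp, X_comp, Int.cast_sub, Int.cast_one, C_sub, C_1,
      Polynomial.one_comp]
    ring

variable (K)

/-- The generalized cusp algebra `A = K + ∑_{i ≥ m} K xⁱ`, as a subalgebra of `K[x, x⁻¹]`. -/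
def cusp (m : ℕ) : Subalgebra K K[T;T⁻¹] where
  carrier := {f | ∀ i : ℤ, f.coeff i ≠ 0 → i = 0 ∨ (m : ℤ) ≤ i}
  mul_mem' := by
    classical
    intro f g hf hg i hi
    have h := AddMonoidAlgebra.support_coeff_mul_subset f g (Finsupp.mem_support_iff.2 hi)
    obtain ⟨j, hj, k, hk, rfl⟩ := Finset.mem_add.1 h
    have h1 := hf j (Finsupp.mem_support_iff.1 hj)
    have h2 := hg k (Finsupp.mem_support_iff.1 hk)
    omega
  add_mem' := by
    intro f g hf hg i hi
    by_cases h : f.coeff i = 0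
    · exact hg i (by simpa [h] using hi)
    · exact hf i h
  algebraMap_mem' := by
    intro r i hi
    left
    by_contra h
    apply hi
    rw [LaurentPolynomial.algebraMap_apply, ← LaurentPolynomial.single_eq_C,
      AddMonoidAlgebra.coeff_single, Finsupp.single_apply, if_neg (Ne.symm h)]

variable {K}

theorem coeff_T (i j : ℤ) : (T i : K[T;T⁻¹]).coeff j = if i = j then 1 else 0 := by
  rw [T, AddMonoidAlgebra.coeff_single, Finsupp.single_apply]

theorem T_mem_cusp {m : ℕ} {i : ℤ} (hi : i = 0 ∨ (m : ℤ) ≤ i) : (T i : K[T;T⁻¹]) ∈ cusp K m := by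
  intro j hj
  have : i = j := by
    by_contra h
    exact hj (by rw [coeff_T, if_neg h])
  exact this ▸ hi

variable (K)

/-- The operator `∂ = d/dx` on `L = K[x, x⁻¹]`. -/
def dOp : Module.End K K[T;T⁻¹] :=
  (Finsupp.lsum K fun i : ℤ => (i : K) • AddMonoidAlgebra.lsingle (i - 1)) ∘ₗ
    (AddMonoidAlgebra.coeffLinearEquiv K).toLinearMap

/-- The operator `h = ∂ x` on `L = K[x, x⁻¹]`. -/
def hOp : Module.End K K[T;T⁻¹] := dOp K * LinearMap.mulLeft K (T 1)

/-- The skew Laurent polynomial ring `D[x, x⁻¹; σ]`, i.e. the localization `A_{1,x}` of the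
first Weyl algebra at the powers of `x`. -/
abbrev WeylX : Type _ := SkewLaurent (sigma K)

variable {K}

theorem dOp_T (i : ℤ) : dOp K (T i) = (i : K) • T (i - 1) := by
  simp only [dOp, T, LinearMap.comp_apply, LinearEquiv.coe_coe]
  change Finsupp.sum (Finsupp.single i 1) _ = _
  rw [Finsupp.sum_single_index (by simp)]
  rfl

theorem hOp_T (i : ℤ) : hOp K (T i) = ((i : K) + 1) • T i := by
  simp only [hOp, Module.End.mul_apply, LinearMap.mulLeft_apply, ← T_add, dOp_T]
  congr 2
  · push_cast; ring
  · ring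

theorem aeval_hOp_T (d : K[X]) (i : ℤ) :
    aeval (hOp K) d (T i) = d.eval ((i : K) + 1) • (T i : K[T;T⁻¹]) := by
  induction d using Polynomial.induction_on' with
  | add p q hp hq => simp [hp, hq, add_smul]
  | monomial n a =>
    have : ∀ n : ℕ, (hOp K ^ n) (T i) = ((i : K) + 1) ^ n • (T i : K[T;T⁻¹]) := by
      intro n
      induction n with
      | zero => simp
      | succ n ih => rw [pow_succ', Module.End.mul_apply, ih, map_smul, hOp_T, smul_smul, pow_succ]
    rw [aeval_monomial]
    rw [Module.End.mul_apply, this, Module.algebraMap_end_apply, smul_smul, eval_monomial]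

theorem end_ext {M : Type*} [AddCommGroup M] [Module K M] {f g : K[T;T⁻¹] →ₗ[K] M}
    (h : ∀ i : ℤ, f (T i) = g (T i)) : f = g := by
  refine AddMonoidAlgebra.lhom_ext' fun i => LinearMap.ext_ring ?_
  exact h i

/-- The multiplications by powers of `x` on `L = K[x, x⁻¹]`. -/
def shiftHom : SkewGrp (sigma K) →* Module.End K K[T;T⁻¹] where
  toFun n := LinearMap.mulLeft K (T (Multiplicative.toAdd (n : Multiplicative ℤ)))
  map_one' := by
    rw [show Multiplicative.toAdd (1 : SkewGrp (sigma K)) = 0 from rfl, T_zero]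
    exact LinearMap.ext fun f => one_mul f
  map_mul' a b := by
    rw [show Multiplicative.toAdd (a * b : SkewGrp (sigma K)) =
      Multiplicative.toAdd (a : Multiplicative ℤ) + Multiplicative.toAdd (b : Multiplicative ℤ)
      from rfl, T_add]
    exact LinearMap.ext fun f => mul_assoc _ _ f

variable (K) in
/-- The action of `D[x, x⁻¹; σ]` on `L = K[x, x⁻¹]`: `x` acts as the multiplication by `x`, and
`h` acts as `∂ x`, so that `h * xⁱ = (i + 1) xⁱ`. -/
def act : WeylX K →+* Module.End K K[T;T⁻¹] :=
  SkewMonoidAlgebra.liftNCRingHom (aeval (hOp K) : K[X] →ₐ[K] Module.End K K[T;T⁻¹]).toRingHom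
    shiftHom (by
      have key : ∀ (n : ℤ) (d : K[X]), aeval (hOp K) (SkewLaurent.xp (sigma K) n • d) *
          LinearMap.mulLeft K (T n) = LinearMap.mulLeft K (T n) * aeval (hOp K) d := by
        intro n d
        rw [SkewLaurent.xp_smul, sigma_zpow_apply]
        refine end_ext fun i => ?_
        simp only [Module.End.mul_apply, LinearMap.mulLeft_apply]
        rw [← T_add, aeval_hOp_T, aeval_hOp_T, mul_smul_comm, ← T_add, Polynomial.eval_comp]
        congr 2
        simp only [eval_sub, eval_X, eval_C, Int.cast_add]
        ring
      exact fun {d g} => key g d)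

theorem act_mono (n : ℤ) (d : K[X]) (f : K[T;T⁻¹]) :
    act K (SkewLaurent.mono (sigma K) n d) f = aeval (hOp K) d (T n * f) := by
  have h : act K (SkewLaurent.mono (sigma K) n d) =
      aeval (hOp K) d * LinearMap.mulLeft K (T n) := SkewMonoidAlgebra.liftNC_single _ _ _ _
  rw [h]
  rfl


theorem cusp_linearMap_ext {m : ℕ} {N : Type*} [AddCommGroup N] [Module K N]
    {f g : cusp K m →ₗ[K] N}
    (h : ∀ (i : ℤ) (hi : i = 0 ∨ (m : ℤ) ≤ i),
      f ⟨T i, T_mem_cusp hi⟩ = g ⟨T i, T_mem_cusp hi⟩) : f = g := by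
  refine LinearMap.ext fun a => ?_
  have ha : a = ∑ i ∈ a.1.coeff.support.attach, a.1.coeff i •
      (⟨T i, T_mem_cusp (a.2 i (Finsupp.mem_support_iff.1 i.2))⟩ : cusp K m) := by
    refine Subtype.ext (LaurentPolynomial.ext fun j => ?_)
    rw [AddSubmonoidClass.coe_finsetSum, AddMonoidAlgebra.coeff_sum, Finsupp.finsetSum_apply]
    simp only [SetLike.val_smul, AddMonoidAlgebra.coeff_smul, Finsupp.smul_apply, coeff_T,
      smul_eq_mul, mul_ite, mul_one, mul_zero]
    rw [Finset.sum_attach _ (fun i => if i = j then a.1.coeff i else 0)]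
    simp
  rw [ha, map_sum, map_sum]
  refine Finset.sum_congr rfl fun i _ => ?_
  rw [map_smul, map_smul, h _ (a.2 i (Finsupp.mem_support_iff.1 i.2))]

theorem act_mono_T (n i : ℤ) (d : K[X]) :
    act K (SkewLaurent.mono (sigma K) n d) (T i) =
      d.eval (((n + i : ℤ) : K) + 1) • (T (n + i) : K[T;T⁻¹]) := by
  rw [act_mono, ← T_add, aeval_hOp_T]

theorem coeff_act_T (w : WeylX K) (i j : ℤ) :
    (act K w (T i)).coeff j =
      (w.coeff (SkewLaurent.xp (sigma K) (j - i))).eval ((j : K) + 1) := by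
  induction w using SkewLaurent.induction_mono with
  | zero => simp
  | add f g hf hg => simp [hf, hg]
  | mono n d =>
    rw [act_mono_T, AddMonoidAlgebra.coeff_smul, Finsupp.smul_apply, coeff_T,
      SkewLaurent.coeff_mono]
    by_cases h : n + i = j
    · rw [if_pos h, if_pos (by omega), h]
      simp
    · rw [if_neg h, if_neg (by omega)]
      simp

section CharZero

variable [CharZero K]

theorem poly_eq_zero {d : K[X]} (N : ℤ) (h : ∀ i : ℤ, N ≤ i → d.eval (i : K) = 0) : d = 0 := by
  refine Polynomial.eq_zero_of_infinite_isRoot d (Set.Infinite.mono (s := (Int.cast : ℤ → K) '' Set.Ici N) ?_ ?_)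
  · rintro _ ⟨i, hi, rfl⟩
    exact h i hi
  · exact (Set.Ici_infinite N).image Int.cast_injective.injOn

theorem act_injective (N : ℤ) {w : WeylX K} (h : ∀ i : ℤ, N ≤ i → act K w (T i) = 0) : w = 0 := by
  refine SkewLaurent.ext_xp fun n => ?_
  refine poly_eq_zero (N + n + 1) fun j hj => ?_
  have h1 := coeff_act_T w (j - 1 - n) (j - 1)
  rw [h _ (by omega), sub_sub_cancel] at h1
  simpa using h1.symm

theorem exists_sub_shift (M : ℕ) (hM : 0 < M) (d : K[X]) :
    ∃ e : K[X], e - e.comp (X - C (M : K)) = d := by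
  suffices H : ∀ (n : ℕ) (d : K[X]), d.natDegree < n → ∃ e : K[X], e - e.comp (X - C (M : K)) = d
    from H _ d (Nat.lt_succ_self _)
  intro n
  induction n with
  | zero => intro d hd; omega
  | succ n ih =>
    intro d hd
    have hM' : (M : K) ≠ 0 := by exact_mod_cast hM.ne'
    have hn : (n : K) + 1 ≠ 0 := by exact_mod_cast n.succ_ne_zero
    set c : K := d.coeff n / ((n + 1) * M) with hc
    set e₁ : K[X] := C c * X ^ (n + 1) with he
    have hcoef : ∀ k, (e₁ - e₁.comp (X - C (M : K))).coeff k =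
        c * ((if k = n + 1 then 1 else 0) - (-(M : K)) ^ (n + 1 - k) * ((n + 1).choose k)) := by
      intro k
      rw [he, mul_comp, C_comp, pow_comp, X_comp, ← mul_sub, coeff_C_mul, coeff_sub, coeff_X_pow,
        sub_eq_add_neg X, ← C_neg, coeff_X_add_C_pow]
    have hlow : ∀ k, n ≤ k → (d - (e₁ - e₁.comp (X - C (M : K)))).coeff k = 0 := by
      intro k hk
      rw [coeff_sub, hcoef]
      rcases hk.eq_or_lt with rfl | hk
      · rw [if_neg (by omega), Nat.add_sub_cancel_left, Nat.choose_succ_self_right, hc]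
        push_cast
        field_simp
        ring
      · rw [coeff_eq_zero_of_natDegree_lt (by omega)]
        rcases eq_or_ne k (n + 1) with rfl | h
        · simp
        · rw [if_neg h, Nat.choose_eq_zero_of_lt (by omega)]
          simp
    rcases Nat.eq_zero_or_pos n with rfl | hpos
    · refine ⟨e₁, ?_⟩
      have : d - (e₁ - e₁.comp (X - C (M : K))) = 0 := by
        ext k
        exact hlow k (Nat.zero_le k)
      exact (sub_eq_zero.1 this).symm
    · obtain ⟨e₂, he₂⟩ := ih (d - (e₁ - e₁.comp (X - C (M : K)))) (by
        refine (Nat.lt_iff_le_pred hpos).2 (natDegree_le_iff_coeff_eq_zero.2 fun k hk => ?_)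
        exact hlow k (by omega))
      refine ⟨e₁ + e₂, ?_⟩
      rw [add_comp]
      linear_combination he₂

theorem exists_commutator (M : ℕ) (hM : 0 < M) (w₀ : WeylX K) :
    ∃ w : WeylX K, w * SkewLaurent.mono (sigma K) M 1 - SkewLaurent.mono (sigma K) M 1 * w = w₀ := by
  induction w₀ using SkewLaurent.induction_mono with
  | zero => exact ⟨0, by simp⟩
  | add f g hf hg =>
    obtain ⟨a, rfl⟩ := hf
    obtain ⟨b, rfl⟩ := hg
    exact ⟨a + b, by rw [add_mul, mul_add]; abel⟩
  | mono n d =>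
    obtain ⟨e, he⟩ := exists_sub_shift M hM d
    refine ⟨SkewLaurent.mono (sigma K) (n - M) e, ?_⟩
    rw [SkewLaurent.mono_mul_mono, SkewLaurent.mono_mul_mono, sigma_zpow_apply, sigma_zpow_apply,
      sub_add_cancel, add_sub_cancel, one_comp, mul_one, one_mul, Int.cast_natCast, ← he]
    simp only [SkewLaurent.mono, sub_eq_add_neg, SkewMonoidAlgebra.single_add,
      SkewMonoidAlgebra.single_neg]

theorem sum_shift_eq_zero (M : ℕ) (hM : 0 < M) (s : K) (d : K[X])
    (h : ∑ i ∈ Finset.range M, d.comp (X + C (s * i)) = 0) : d = 0 := by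
  by_contra hd
  have h1 := congrArg (fun p => p.coeff d.natDegree) h
  have h2 : ∀ c : K, (d.comp (X + C c)).coeff d.natDegree = d.leadingCoeff := by
    intro c
    have : (d.comp (X + C c)).natDegree = d.natDegree := by simp [natDegree_comp]
    conv_lhs => rw [← this]
    change (d.comp (X + C c)).leadingCoeff = _
    rw [leadingCoeff_comp (by simp)]
    simp
  simp only [finsetSum_coeff, h2, Finset.sum_const, Finset.card_range, nsmul_eq_mul, coeff_zero,
    mul_eq_zero, Nat.cast_eq_zero, leadingCoeff_eq_zero] at h1
  exact h1.elim hM.ne' hd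


/-- Every differential operator on `A` is the restriction of the action of an element of
`D[x, x⁻¹; σ]`. -/
theorem exists_act_eq (m n : ℕ) (f : Module.End K (cusp K m))
    (hf : f ∈ diffOpsLT K (cusp K m) n) :
    ∃ w : WeylX K, ∀ a : cusp K m, act K w a = f a := by
  induction n generalizing f with
  | zero =>
    have : f = 0 := by simpa [diffOpsLT] using hf
    exact ⟨0, by simp [this]⟩
  | succ n ih =>
    obtain ⟨M, hM0, hM⟩ : ∃ M : ℕ, 0 < M ∧ m ≤ M := ⟨m + 1, by omega, by omega⟩
    have hmem : ∀ k : ℕ, (T ((M * k : ℕ) : ℤ) : K[T;T⁻¹]) ∈ cusp K m := by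
      intro k
      refine T_mem_cusp ?_
      rcases k with _ | k
      · simp
      · right
        have : M ≤ M * (k + 1) := Nat.le_mul_of_pos_right M (Nat.succ_pos k)
        exact_mod_cast hM.trans this
    have hmem' : ∀ k : ℕ, (T (((M + 1) * k : ℕ) : ℤ) : K[T;T⁻¹]) ∈ cusp K m := by
      intro k
      refine T_mem_cusp ?_
      rcases k with _ | k
      · simp
      · right
        have : M + 1 ≤ (M + 1) * (k + 1) := Nat.le_mul_of_pos_right _ (Nat.succ_pos k)
        exact_mod_cast (hM.trans (Nat.le_succ M)).trans this
    set u : ℕ → cusp K m := fun k => ⟨_, hmem k⟩ with hu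
    set v : ℕ → cusp K m := fun k => ⟨_, hmem' k⟩ with hv
    obtain ⟨w₀, hw₀⟩ := ih _ (hf (u 1))
    obtain ⟨w₁, hw₁⟩ := ih _ (hf (v 1))
    obtain ⟨w, hw⟩ := exists_commutator M hM0 w₀
    have hX : ∀ (k : ℤ) (y : K[T;T⁻¹]), act K (SkewLaurent.mono (sigma K) k 1) y = T k * y := by
      intro k y
      rw [act_mono]
      simp
    -- `g` commutes with `x ^ M`
    set g : cusp K m → K[T;T⁻¹] := fun a => f a - act K w a with hg
    have hgu1 : ∀ a, g (u 1 * a) = T (M : ℤ) * g a := by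
      intro a
      have h1 := hw₀ a
      rw [← hw, map_sub, map_mul, map_mul, LinearMap.sub_apply, Module.End.mul_apply,
        Module.End.mul_apply, hX, hX] at h1
      simp only [LinearMap.sub_apply, Module.End.mul_apply, LinearMap.mulLeft_apply,
        AddSubgroupClass.coe_sub, MulMemClass.coe_mul, hu, mul_one] at h1
      simp only [hg, hu, MulMemClass.coe_mul, mul_one]
      linear_combination -h1
    have hgu : ∀ (k : ℕ) a, g (u k * a) = T ((M * k : ℕ) : ℤ) * g a := by
      intro k
      induction k with
      | zero =>
        intro a
        have : u 0 * a = a := by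
          apply Subtype.ext
          simp [hu]
        simp [this]
      | succ k ihk =>
        intro a
        have : u (k + 1) * a = u 1 * (u k * a) := by
          apply Subtype.ext
          simp only [hu, MulMemClass.coe_mul, ← mul_assoc, ← T_add]
          congr 2
          push_cast
          ring
        rw [this, hgu1, ihk, ← mul_assoc, ← T_add]
        congr 2
        push_cast
        ring
    -- the commutator of `g` with `x ^ (M + 1)`
    set q : WeylX K := w₁ - (w * SkewLaurent.mono (sigma K) ((M : ℤ) + 1) 1 -
      SkewLaurent.mono (sigma K) ((M : ℤ) + 1) 1 * w) with hq
    have hqa : ∀ a : cusp K m, act K q a = g (v 1 * a) - T ((M : ℤ) + 1) * g a := by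
      intro a
      have h1 := hw₁ a
      simp only [LinearMap.sub_apply, Module.End.mul_apply, LinearMap.mulLeft_apply,
        AddSubgroupClass.coe_sub, MulMemClass.coe_mul, hv, mul_one, Nat.cast_add,
        Nat.cast_one] at h1
      rw [hq, map_sub, map_sub, map_mul, map_mul, LinearMap.sub_apply, LinearMap.sub_apply,
        Module.End.mul_apply, Module.End.mul_apply, hX, hX, h1]
      simp only [hg, hv, MulMemClass.coe_mul, mul_one, Nat.cast_add, Nat.cast_one]
      ring
    have hvs : ∀ (k : ℕ) a, v (k + 1) * a = v 1 * (v k * a) := by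
      intro k a
      apply Subtype.ext
      simp only [hv, MulMemClass.coe_mul, ← mul_assoc, ← T_add]
      congr 2
      push_cast
      ring
    have htel : ∀ (k : ℕ) (a : cusp K m), g (v k * a) - T (((M : ℤ) + 1) * k) * g a =
        ∑ i ∈ Finset.range k, T (((M : ℤ) + 1) * ((k : ℤ) - 1 - i)) *
          act K q (v i * a : cusp K m) := by
      intro k a
      induction k with
      | zero =>
        have : v 0 * a = a := by
          apply Subtype.ext
          simp [hv]
        simp [this]
      | succ k ihk =>
        rw [Finset.sum_range_succ, hvs]
        have h1 : ∑ i ∈ Finset.range k, T (((M : ℤ) + 1) * (((k + 1 : ℕ) : ℤ) - 1 - i)) *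
            act K q (v i * a : cusp K m) = T ((M : ℤ) + 1) * (g (v k * a) -
              T (((M : ℤ) + 1) * k) * g a) := by
          rw [ihk, Finset.mul_sum]
          refine Finset.sum_congr rfl fun i _ => ?_
          rw [← mul_assoc, ← T_add]
          congr 2
          push_cast
          ring
        have h2 : ((M : ℤ) + 1) * (((k + 1 : ℕ) : ℤ) - 1 - k) = 0 := by push_cast; ring
        have h3 : ((M : ℤ) + 1) + ((M : ℤ) + 1) * k = ((M : ℤ) + 1) * ((k + 1 : ℕ) : ℤ) := by
          push_cast; ring
        have h4 := congrArg (fun z => (T z : K[T;T⁻¹])) h3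
        simp only [T_add (M + 1 : ℤ) ((M + 1 : ℤ) * k)] at h4
        rw [h1, hqa, h2, T_zero, ← h4]
        ring
    have hsum : ∀ a : cusp K m, ∑ i ∈ Finset.range M, T (((M : ℤ) + 1) * ((M : ℤ) - 1 - i)) *
          act K q (v i * a : cusp K m) = 0 := by
      intro a
      have h1 : v M = u (M + 1) := by
        apply Subtype.ext
        simp only [hu, hv]
        congr 1
        push_cast
        ring
      rw [← htel, h1, hgu, sub_eq_zero]
      congr 2
      push_cast
      ring
    have hq0 : q = 0 := by
      refine SkewLaurent.ext_xp fun n => ?_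
      rw [SkewMonoidAlgebra.coeff_zero, Finsupp.zero_apply]
      refine sum_shift_eq_zero M hM0 ((M : K) + 1) _ ?_
      refine poly_eq_zero ((m : ℤ) + n + 1) fun j hj => ?_
      have ht : (T (j - 1 - n) : K[T;T⁻¹]) ∈ cusp K m := T_mem_cusp (Or.inr (by omega))
      have h1 := congrArg (fun y => y.coeff (j - 1 + ((M : ℤ) + 1) * ((M : ℤ) - 1))) (hsum ⟨_, ht⟩)
      simp only [AddMonoidAlgebra.coeff_sum, Finsupp.finsetSum_apply, AddMonoidAlgebra.coeff_zero,
        Finsupp.zero_apply] at h1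
      rw [eval_finsetSum, ← h1]
      refine Finset.sum_congr rfl fun i _ => ?_
      rw [T, AddMonoidAlgebra.coeff_single_mul_apply, one_mul]
      simp only [hv, MulMemClass.coe_mul, ← T_add]
      rw [coeff_act_T, eval_comp]
      congr 1
      · simp only [eval_add, eval_X, eval_C]
        push_cast
        ring
      · congr 2
        push_cast
        ring
    -- so `g` is the multiplication by `g 1`
    have hgv : ∀ (k : ℕ) a, g (v k * a) = T (((M : ℤ) + 1) * k) * g a := by
      intro k a
      rw [← sub_eq_zero, htel]
      simp [hq0]
    have hgT : ∀ (k : ℕ) (hk : (T (k : ℤ) : K[T;T⁻¹]) ∈ cusp K m), g ⟨_, hk⟩ = T k * g 1 := by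
      intro k hk
      have h1 : u k * ⟨_, hk⟩ = v k * 1 := by
        apply Subtype.ext
        simp only [hu, hv, MulMemClass.coe_mul, ← T_add, mul_one]
        congr 1
        push_cast
        ring
      have h2 := hgu k ⟨_, hk⟩
      rw [h1, hgv] at h2
      have h3 := congrArg (fun y => T (-((M * k : ℕ) : ℤ)) * y) h2
      simp only [← mul_assoc, ← T_add] at h3
      rw [neg_add_cancel, T_zero, one_mul] at h3
      rw [← h3]
      congr 2
      push_cast
      ring
    obtain ⟨wy, hwy⟩ : ∃ wy : WeylX K, ∀ z, act K wy z = g 1 * z := by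
      induction g 1 using LaurentPolynomial.induction_on' with
      | add a b ha hb =>
        obtain ⟨wa, hwa⟩ := ha
        obtain ⟨wb, hwb⟩ := hb
        exact ⟨wa + wb, fun z => by rw [map_add, LinearMap.add_apply, hwa, hwb, add_mul]⟩
      | C_mul_T n c =>
        refine ⟨SkewLaurent.mono (sigma K) n (C c), fun z => ?_⟩
        rw [act_mono, aeval_C, Module.algebraMap_end_apply, LaurentPolynomial.smul_eq_C_mul,
          mul_assoc]
    refine ⟨w + wy, fun a => ?_⟩
    have hlin : (act K w + act K wy) ∘ₗ (cusp K m).val.toLinearMap =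
        (cusp K m).val.toLinearMap ∘ₗ f := by
      refine cusp_linearMap_ext fun i hi => ?_
      obtain ⟨k, rfl⟩ : ∃ k : ℕ, i = k := ⟨i.toNat, by omega⟩
      have h1 := hgT k (T_mem_cusp hi)
      simp only [LinearMap.comp_apply, LinearMap.add_apply, AlgHom.toLinearMap_apply,
        Subalgebra.coe_val, hwy]
      rw [mul_comm, ← h1]
      simp only [hg]
      ring
    rw [map_add]
    exact LinearMap.congr_fun hlin a

theorem act_ext (m : ℕ) {w w' : WeylX K} (h : ∀ a : cusp K m, act K w a = act K w' a) :
    w = w' := by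
  rw [← sub_eq_zero]
  refine act_injective m fun i hi => ?_
  rw [map_sub, LinearMap.sub_apply, h ⟨T i, T_mem_cusp (Or.inr hi)⟩, sub_self]

variable (K) in
/-- The ring `𝒟(A)` of differential operators on the generalized cusp algebra. -/
abbrev DA (m : ℕ) : Type _ := diffOps K (cusp K m)

theorem exists_toWeylX {m : ℕ} (f : DA K m) : ∃ w : WeylX K, ∀ a : cusp K m, act K w a = f.1 a :=
  exists_act_eq m f.2.choose f.1 f.2.choose_spec

variable (K) in
/-- The embedding `𝒟(A) ⊂ D[x, x⁻¹; σ]`: a differential operator `f` on `A` is sent to the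
unique element of `D[x, x⁻¹; σ]` whose action on `K[x, x⁻¹]` extends `f`. -/
def toWeylX (m : ℕ) : DA K m →+* WeylX K where
  toFun f := (exists_toWeylX f).choose
  map_one' := act_ext m fun a => by
    rw [(exists_toWeylX _).choose_spec, map_one]
    rfl
  map_zero' := act_ext m fun a => by
    rw [(exists_toWeylX _).choose_spec, map_zero]
    rfl
  map_mul' f g := act_ext m fun a => by
    rw [(exists_toWeylX _).choose_spec, map_mul, Module.End.mul_apply,
      (exists_toWeylX g).choose_spec, (exists_toWeylX f).choose_spec]
    rfl
  map_add' f g := act_ext m fun a => by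
    rw [(exists_toWeylX _).choose_spec, map_add, LinearMap.add_apply,
      (exists_toWeylX g).choose_spec, (exists_toWeylX f).choose_spec]
    rfl

/-- The defining property of the embedding `𝒟(A) ⊂ D[x, x⁻¹; σ]`. -/
theorem act_toWeylX {m : ℕ} (f : DA K m) (a : cusp K m) : act K (toWeylX K m f) a = f.1 a :=
  (exists_toWeylX f).choose_spec a

end CharZero

theorem hOp_mul (y z : K[T;T⁻¹]) : hOp K (y * z) = y * hOp K z + (hOp K y - y) * z := by
  have h : ∀ i : ℤ, ∀ z : K[T;T⁻¹],
      hOp K (T i * z) = T i * hOp K z + (hOp K (T i) - T i) * z := by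
    intro i z
    have : hOp K ∘ₗ LinearMap.mulLeft K (T i) =
        LinearMap.mulLeft K (T i) ∘ₗ hOp K + LinearMap.mulLeft K (hOp K (T i) - T i) := by
      refine end_ext fun j => ?_
      simp only [LinearMap.comp_apply, LinearMap.add_apply, LinearMap.mulLeft_apply, ← T_add,
        hOp_T, LaurentPolynomial.smul_eq_C_mul, sub_mul, mul_assoc]
      rw [mul_left_comm, ← T_add]
      simp only [map_add, map_one, Int.cast_add]
      ring
    exact LinearMap.congr_fun this z
  induction y using LaurentPolynomial.induction_on' with
  | add a b ha hb => rw [add_mul, map_add, ha, hb, map_add]; ring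
  | C_mul_T n c =>
    rw [← LaurentPolynomial.smul_eq_C_mul, smul_mul_assoc, map_smul, h, map_smul, ← smul_sub,
      smul_mul_assoc, smul_mul_assoc, smul_add]

theorem hOp_mem_cusp {m : ℕ} {f : K[T;T⁻¹]} (hf : f ∈ cusp K m) : hOp K f ∈ cusp K m := by
  have h : (Subalgebra.toSubmodule (cusp K m)).mkQ ∘ₗ hOp K ∘ₗ (cusp K m).val.toLinearMap = 0 := by
    refine cusp_linearMap_ext fun i hi => ?_
    simp only [LinearMap.comp_apply, LinearMap.zero_apply, Submodule.mkQ_apply,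
      Submodule.Quotient.mk_eq_zero, AlgHom.toLinearMap_apply, Subalgebra.coe_val, hOp_T]
    exact (cusp K m).smul_mem (T_mem_cusp hi) _
  exact (Submodule.Quotient.mk_eq_zero _).1 (LinearMap.congr_fun h ⟨f, hf⟩)

variable (K)

/-- The element `h = ∂ x` of `𝒟(A)`. -/
def hD (m : ℕ) : diffOps K (cusp K m) :=
  ⟨(hOp K).restrict (p := Subalgebra.toSubmodule (cusp K m))
      (q := Subalgebra.toSubmodule (cusp K m)) fun _ hf => hOp_mem_cusp hf, 2, by
    intro a
    have h : (hOp K (a : K[T;T⁻¹]) - a) ∈ cusp K m := sub_mem (hOp_mem_cusp a.2) a.2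
    convert mulLeft_mem_diffOpsLT (K := K) (⟨_, h⟩ : cusp K m) using 1
    refine LinearMap.ext fun b => Subtype.ext ?_
    change hOp K ((a : K[T;T⁻¹]) * b) - (a : K[T;T⁻¹]) * hOp K b = _ * (b : K[T;T⁻¹])
    rw [hOp_mul]
    ring⟩

/-! ### Torsion modules, weight modules and supports -/

/-- The inclusion `D = K[h] → 𝒟(A)`. -/
def dToDA (m : ℕ) : K[X] →ₐ[K] diffOps K (cusp K m) := aeval (hD K m)

section Weights

variable (m : ℕ) (M : Type*) [AddCommGroup M] [Module (diffOps K (cusp K m)) M]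

/-- A `𝒟(A)`-module is `D`-torsion if every element is annihilated by a nonzero element of
`D = K[h]`. -/
def IsDTorsion : Prop := ∀ v : M, ∃ d : K[X], d ≠ 0 ∧ dToDA K m d • v = 0

/-- The component `M_𝔭 = {v ∈ M | 𝔭 v = 0}` of weight `𝔭`. -/
def weightSpace (p : MaximalSpectrum K[X]) : AddSubgroup M where
  carrier := {v | ∀ d ∈ p.asIdeal, dToDA K m d • v = 0}
  add_mem' := by
    intro a b ha hb d hd
    rw [smul_add, ha d hd, hb d hd, add_zero]
  zero_mem' := by
    intro d _
    exact smul_zero _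
  neg_mem' := by
    intro a ha d hd
    rw [smul_neg, ha d hd, neg_zero]

open Classical in
/-- A `𝒟(A)`-module is weight if it is the direct sum of its components `M_𝔭`, where `𝔭` runs
through the maximal ideals of `D = K[h]`. -/
def IsWeight : Prop := DirectSum.IsInternal (weightSpace K m M)

/-- The support of a `𝒟(A)`-module: the set of all `𝔭` with `M_𝔭 ≠ 0`. -/
def supp : Set (MaximalSpectrum K[X]) := {p | weightSpace K m M p ≠ ⊥}

end Weights

variable {K} in
/-- The orbit `{σⁱ(𝔭) | i ∈ ℤ}` of a maximal ideal of `D = K[h]`. -/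
def orbit (p : MaximalSpectrum K[X]) : Set (MaximalSpectrum K[X]) :=
  {q | ∃ i : ℤ, q.asIdeal = p.asIdeal.map (sigma K ^ i)}

/-- The maximal ideal `(h)` of `D = K[h]`. -/
def hIdeal : MaximalSpectrum K[X] :=
  ⟨Ideal.span {X}, PrincipalIdealRing.isMaximal_of_irreducible irreducible_X⟩

/-- The set of all `σ`-orbits in the set of maximal ideals of `D` other than the orbit of `(h)`. -/
def OtherOrbit : Type _ :=
  {O : Set (MaximalSpectrum K[X]) // (∃ p, O = orbit p) ∧ O ≠ orbit (hIdeal K)}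

/-! ### The algebra `𝔹 = T⁻¹D[x, x⁻¹; σ]` -/

/-- The multiplicative submonoid `T` of `D = K[h]` generated by all `h - i`, `i ∈ ℤ`. -/
def shiftMonoid : Submonoid K[X] := Submonoid.closure (Set.range fun i : ℤ => X - C (i : K))

/-- The localization `T⁻¹D`. -/
abbrev TinvD : Type _ := Localization (shiftMonoid K)

theorem map_shiftMonoid :
    (shiftMonoid K).map (sigma K).toMonoidHom = shiftMonoid K := by
  have h : ∀ i : ℤ, (sigma K).toMonoidHom (X - C (i : K)) = X - C ((i + 1 : ℤ) : K) := by
    intro i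
    change sigma K _ = _
    rw [sigma_apply]
    simp
    ring
  rw [shiftMonoid, MonoidHom.map_mclosure, ← Set.range_comp]
  congr 1
  ext d
  constructor
  · rintro ⟨i, rfl⟩
    exact ⟨i + 1, (h i).symm⟩
  · rintro ⟨i, rfl⟩
    exact ⟨i - 1, by rw [Function.comp_apply, h, sub_add_cancel]⟩

/-- The automorphism of `T⁻¹D` induced by `σ`. -/
def sigmaT : RingAut (TinvD K) :=
  IsLocalization.ringEquivOfRingEquiv (TinvD K) (TinvD K) (sigma K) (map_shiftMonoid K)

/-- The algebra `𝔹 = T⁻¹D[x, x⁻¹; σ]`. -/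
abbrev BRing : Type _ := SkewLaurent (sigmaT K)

variable {K} in
theorem sigmaT_zpow_algebraMap (n : ℤ) (d : K[X]) :
    (sigmaT K ^ n) (algebraMap K[X] (TinvD K) d) = algebraMap K[X] (TinvD K) ((sigma K ^ n) d) := by
  have h1 : ∀ d, sigmaT K (algebraMap K[X] (TinvD K) d) =
      algebraMap K[X] (TinvD K) (sigma K d) := fun d =>
    IsLocalization.ringEquivOfRingEquiv_eq _ _
  have h2 : ∀ d, (sigmaT K)⁻¹ (algebraMap K[X] (TinvD K) d) =
      algebraMap K[X] (TinvD K) ((sigma K)⁻¹ d) := by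
    intro d
    apply (sigmaT K).injective
    rw [h1]
    have h3 : sigma K ((sigma K)⁻¹ d) = d := (sigma K).apply_symm_apply d
    rw [h3]
    exact (sigmaT K).apply_symm_apply _
  induction n generalizing d with
  | zero => simp
  | succ n ih => rw [zpow_add_one, zpow_add_one, RingAut.mul_apply, RingAut.mul_apply, h1, ih]
  | pred n ih => rw [zpow_sub_one, zpow_sub_one, RingAut.mul_apply, RingAut.mul_apply, h2, ih]

/-- The inclusion `D = K[h] → T⁻¹D → 𝔹`. -/
def dToB : K[X] →+* BRing K := (SkewLaurent.const (sigmaT K)).comp (algebraMap K[X] (TinvD K))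

/-- The inclusion `D[x, x⁻¹; σ] → 𝔹`, `∑ dᵢ xⁱ ↦ ∑ dᵢ xⁱ`. -/
def weylXToB : WeylX K →+* BRing K :=
  SkewMonoidAlgebra.liftNCRingHom (dToB K)
    { toFun := fun g => SkewLaurent.mono (sigmaT K) (Multiplicative.toAdd g) 1
      map_one' := rfl
      map_mul' := fun a b => by
        rw [SkewLaurent.mono_mul_mono, map_one, mul_one]
        rfl }
    (by
      intro d g
      change SkewLaurent.mono (sigmaT K) 0 _ * SkewLaurent.mono (sigmaT K) _ 1 =
        SkewLaurent.mono (sigmaT K) _ 1 * SkewLaurent.mono (sigmaT K) 0 _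
      rw [SkewLaurent.mono_mul_mono, SkewLaurent.mono_mul_mono, one_mul, map_one, mul_one,
        zero_add, add_zero, sigmaT_zpow_algebraMap]
      rfl)

/-- The `𝔹`-module `𝔹/𝔹𝔭`. -/
abbrev BQuot (p : MaximalSpectrum K[X]) : Type _ :=
  BRing K ⧸ (Submodule.span (BRing K) (dToB K '' p.asIdeal) : Submodule (BRing K) (BRing K))

/-- A `𝔹`-module is `T⁻¹D`-torsion if every element is annihilated by a nonzero element of
`T⁻¹D`. -/
def IsTinvDTorsion (N : Type*) [AddCommGroup N] [Module (BRing K) N] : Prop :=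
  ∀ v : N, ∃ c : TinvD K, c ≠ 0 ∧ SkewLaurent.const (sigmaT K) c • v = 0

/-! ### The `𝒟(A)`-modules obtained from `K[x, x⁻¹]` and from `𝔹`-modules -/

section Modules

variable [CharZero K] (m : ℕ)

/-- The Laurent polynomial algebra `L = K[x, x⁻¹]` as a `𝒟(A)`-module: a differential operator on
`A` acts through its unique extension to `L` in `D[x, x⁻¹; σ]`. -/
def LMod (_m : ℕ) : Type _ := K[T;T⁻¹]

instance : AddCommGroup (LMod K m) := inferInstanceAs (AddCommGroup K[T;T⁻¹])

instance : Module (DA K m) (LMod K m) :=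
  Module.compHom K[T;T⁻¹] ((act K).comp (toWeylX K m))

/-- The `𝒟(A)`-submodule `A` of `L`. -/
def cuspInL : Submodule (DA K m) (LMod K m) where
  carrier := {f : K[T;T⁻¹] | f ∈ cusp K m}
  add_mem' := fun {a b} ha hb => (cusp K m).add_mem ha hb
  zero_mem' := (cusp K m).zero_mem
  smul_mem' := by
    intro f a ha
    change act K (toWeylX K m f) a ∈ cusp K m
    have h := act_toWeylX f ⟨a, ha⟩
    exact h ▸ (f.1 ⟨a, ha⟩).2

/-- The `𝒟(A)`-module `A' = L/A` complementary to `A`. -/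
abbrev ComplMod : Type _ := LMod K m ⧸ cuspInL K m

/-- The embedding `𝒟(A) ⊂ 𝔹`. -/
def daToB : DA K m →+* BRing K := (weylXToB K).comp (toWeylX K m)

/-- The restriction of a `𝔹`-module to the subalgebra `𝒟(A)` of `𝔹`. -/
def Res (_m : ℕ) (N : Type*) : Type _ := N

instance (N : Type*) [AddCommGroup N] : AddCommGroup (Res m N) := inferInstanceAs (AddCommGroup N)

instance (N : Type*) [AddCommGroup N] [Module (BRing K) N] : Module (DA K m) (Res m N) :=
  Module.compHom N (daToB K m)

end Modules

end Cusp

end CuspD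

end

open CuspD

universe u v w

noncomputable section

namespace CuspD

open scoped LaurentPolynomial
open LaurentPolynomial (T T_add T_zero)
open CuspD.SkewLaurent (mono const xp)

/-! The ring `𝒟(A)` is a graded subring of `D[x, x⁻¹; σ]`: every operator is a finite sum of
operators `d xⁿ` that themselves preserve `A` (`exists_eq_sum_homog`), and `d xⁿ` carries weight `𝔭`
to weight `σⁿ(𝔭)`. In characteristic zero the ideals `σⁿ(𝔭)` are pairwise distinct
(`shift_injective`), and by the Chinese remainder theorem elements of `D` separate weight
components. A simple `D`-torsion module contains a weight vector, and the vector generates it, so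
the module is weight.

The central fact is that the annihilator of a nonzero weight vector in a simple module depends only
on the weight (`smul_eq_zero_of_smul_eq_zero`). Hence simple modules with a common weight are
isomorphic (`nonempty_equiv_of_mem_supp`), and the classification reduces to exhibiting, for each
`𝔭`, one simple torsion module with `𝔭` in its support.

On the orbit of `(h)` these are `A` and `A'`, whose supports partition the orbit. On any other orbit
`T` is invertible modulo every weight, so the powers of `x` become available up to elements of `D`,
and `𝔹/𝔹𝔭` remains simple over `𝒟(A)` with the whole orbit as support. Both cases use one criterion,
`isSimpleModule_of_weight_family`, together with the operators of `exists_preserves`.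
Non-isomorphism and infinite dimension are read off from supports. -/

theorem SkewLaurent.exists_eq_sum_mono {R : Type*} [CommRing R] {τ : RingAut R}
    (w : SkewLaurent τ) : ∃ s : Finset ℤ, w = ∑ n ∈ s, mono τ n (w.coeff (xp τ n)) := by
  let e : SkewGrp τ ↪ ℤ := (Multiplicative.toAdd : Multiplicative ℤ ≃ ℤ).toEmbedding
  refine ⟨w.support.map e, ?_⟩
  rw [Finset.sum_map]
  exact w.sum_single.symm

/-! ### Homogeneous differential operators `d xⁿ` on `A`. -/

section Homogeneous

variable {K : Type*} [Field K]

/-- The set of exponents of the monomials in the generalized cusp algebra. -/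
def expts (m : ℕ) : Set ℤ := {i | i = 0 ∨ (m : ℤ) ≤ i}

/-- A translation of the variable keeps the degree and the leading coefficient, so the leading terms
cancel. -/
theorem degree_sub_comp_lt {n : ℕ} {d : K[X]} (hd : d ∈ degreeLT K (n + 1)) (a : K) :
    d - d.comp (X - C a) ∈ degreeLT K n := by
  have h : d.comp (X - C a) = taylor (-a) d := by
    rw [taylor_apply, C_neg, sub_eq_add_neg]
  rw [h]
  rcases eq_or_ne d 0 with rfl | h0
  · simp
  rw [mem_degreeLT] at hd ⊢
  have h1 : (d - taylor (-a) d).degree < d.degree :=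
    degree_sub_lt_left (degree_taylor _ _).symm h0 (leadingCoeff_taylor _ _).symm
  refine h1.trans_le ?_
  rw [degree_eq_natDegree h0] at hd ⊢
  exact_mod_cast Nat.lt_succ_iff.1 (by exact_mod_cast hd)

variable (K) in
/-- The sums of monomials `d xⁱ` with `deg d < n`. -/
def weylLT (n : ℕ) : AddSubgroup (WeylX K) :=
  AddSubgroup.closure {w | ∃ (i : ℤ) (d : K[X]), d ∈ degreeLT K n ∧ w = mono (sigma K) i d}

theorem mono_add (i : ℤ) (a b : K[X]) :
    mono (sigma K) i (a + b) = mono (sigma K) i a + mono (sigma K) i b :=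
  SkewMonoidAlgebra.single_add _ _ _

theorem mono_sub (i : ℤ) (a b : K[X]) :
    mono (sigma K) i (a - b) = mono (sigma K) i a - mono (sigma K) i b := by
  rw [eq_sub_iff_add_eq, ← mono_add, sub_add_cancel]

/-- The commutator of `d xʲ` with `c xⁱ` is `c (d - σⁱ(d)) xⁱ⁺ʲ`, so the degree in `h` drops. -/
theorem commutator_mem_weylLT {n : ℕ} {w : WeylX K} (hw : w ∈ weylLT K (n + 1)) (i : ℤ) (c : K) :
    w * mono (sigma K) i (C c) - mono (sigma K) i (C c) * w ∈ weylLT K n := by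
  induction hw using AddSubgroup.closure_induction with
  | mem w hw =>
    obtain ⟨j, d, hd, rfl⟩ := hw
    refine AddSubgroup.subset_closure ⟨j + i, c • (d - d.comp (X - C (i : K))),
      (degreeLT K n).smul_mem _ (degree_sub_comp_lt hd _), ?_⟩
    rw [SkewLaurent.mono_mul_mono, SkewLaurent.mono_mul_mono, add_comm i j, ← mono_sub,
      sigma_zpow_apply, sigma_zpow_apply, C_comp, mul_comm d, ← mul_sub, smul_eq_C_mul]
  | zero => simp
  | add a b _ _ ha hb =>
    convert add_mem ha hb using 1
    noncomm_ring
  | neg a _ ha =>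
    convert neg_mem ha using 1
    noncomm_ring

theorem act_mono_C (i : ℤ) (c : K) (z : K[T;T⁻¹]) :
    act K (mono (sigma K) i (C c)) z = LaurentPolynomial.C c * T i * z := by
  rw [act_mono, aeval_C, Module.algebraMap_end_apply, LaurentPolynomial.smul_eq_C_mul, mul_assoc]

theorem exists_act_commutator {n : ℕ} {w : WeylX K} (hw : w ∈ weylLT K (n + 1)) (y : K[T;T⁻¹]) :
    ∃ w' ∈ weylLT K n, ∀ z, act K w' z = act K w (y * z) - y * act K w z := by
  induction y using LaurentPolynomial.induction_on' with
  | add a b ha hb =>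
    obtain ⟨wa, ha, ha'⟩ := ha
    obtain ⟨wb, hb, hb'⟩ := hb
    refine ⟨wa + wb, add_mem ha hb, fun z => ?_⟩
    rw [map_add, LinearMap.add_apply, ha', hb', add_mul, add_mul, map_add]
    ring
  | C_mul_T i c =>
    refine ⟨_, commutator_mem_weylLT hw i c, fun z => ?_⟩
    rw [map_sub, map_mul, map_mul, LinearMap.sub_apply, Module.End.mul_apply, Module.End.mul_apply,
      act_mono_C, act_mono_C]

/-- The degree in `h` bounds the order, since each commutator with a multiplication lowers it. This
makes any element of `D[x, x⁻¹; σ]` preserving `A` a differential operator on `A`. -/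
theorem mem_diffOpsLT_of_act {m n : ℕ} {w : WeylX K} (hw : w ∈ weylLT K n)
    (f : Module.End K (cusp K m)) (hf : ∀ a, (f a : K[T;T⁻¹]) = act K w a) :
    f ∈ diffOpsLT K (cusp K m) n := by
  induction n generalizing w f with
  | zero =>
    have h0 : w = 0 := by
      refine (AddSubgroup.closure_le (K := ⊥)).2 ?_ hw
      rintro _ ⟨i, d, hd, rfl⟩
      have : d = 0 := by simpa [mem_degreeLT] using hd
      simp [this, mono]
    have : f = 0 := LinearMap.ext fun a => Subtype.ext (by simp [hf, h0])
    simp [this]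
  | succ n ih =>
    intro a
    obtain ⟨w', hw', h⟩ := exists_act_commutator hw (a : K[T;T⁻¹])
    refine ih hw' _ fun b => ?_
    rw [h, ← hf]
    exact congrArg (· - _) (hf (a * b))

/-- The condition on `d` for `d xⁿ` to preserve the generalized cusp algebra. -/
def Preserves (m : ℕ) (n : ℤ) (d : K[X]) : Prop :=
  ∀ k ∈ expts m, k + n ∉ expts m → d.eval (((k + n : ℤ) : K) + 1) = 0

theorem act_mem_cusp {m : ℕ} {w : WeylX K}
    (hw : ∀ i ∈ expts m, act K w (T i) ∈ cusp K m) {f : K[T;T⁻¹]} (hf : f ∈ cusp K m) :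
    act K w f ∈ cusp K m := by
  have h : (Subalgebra.toSubmodule (cusp K m)).mkQ ∘ₗ act K w ∘ₗ
      (cusp K m).val.toLinearMap = 0 := by
    refine cusp_linearMap_ext fun i hi => ?_
    simp only [LinearMap.comp_apply, LinearMap.zero_apply, Submodule.mkQ_apply,
      Submodule.Quotient.mk_eq_zero, AlgHom.toLinearMap_apply, Subalgebra.coe_val]
    exact hw i hi
  exact (Submodule.Quotient.mk_eq_zero _).1 (LinearMap.congr_fun h ⟨f, hf⟩)

/-- The operator `d xⁿ` sends `xᵏ` to `d(k + n + 1) xᵏ⁺ⁿ`, because `h` has eigenvalue `i + 1` on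
`xⁱ`; hence the offset by one in `Preserves`. -/
theorem act_mono_mem_cusp {m : ℕ} {n : ℤ} {d : K[X]} (hd : Preserves m n d) {f : K[T;T⁻¹]}
    (hf : f ∈ cusp K m) : act K (mono (sigma K) n d) f ∈ cusp K m := by
  refine act_mem_cusp (fun i hi => ?_) hf
  rw [act_mono_T]
  by_cases h : i + n ∈ expts m
  · exact (cusp K m).smul_mem (T_mem_cusp (by rwa [add_comm])) _
  · rw [add_comm n i, hd i hi h, zero_smul]
    exact zero_mem _

/-- The differential operator on the generalized cusp algebra given by `d xⁿ`. -/
def homog (m : ℕ) (n : ℤ) (d : K[X]) (hd : Preserves m n d) : DA K m :=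
  ⟨(act K (mono (sigma K) n d)).restrict (p := Subalgebra.toSubmodule (cusp K m))
      (q := Subalgebra.toSubmodule (cusp K m)) fun _ hf => act_mono_mem_cusp hd hf,
    d.natDegree + 1, mem_diffOpsLT_of_act (w := mono (sigma K) n d)
      (AddSubgroup.subset_closure ⟨n, d, mem_degreeLT.2
        (degree_le_natDegree.trans_lt (by exact_mod_cast Nat.lt_succ_self _)), rfl⟩) _
      fun _ => rfl⟩

/-! ### The grading of `𝒟(A)` inherited from `D[x, x⁻¹; σ]`. -/

section Embedding

variable [CharZero K]

theorem toWeylX_eq {m : ℕ} {f : DA K m} {w : WeylX K}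
    (h : ∀ a : cusp K m, (f.1 a : K[T;T⁻¹]) = act K w a) : toWeylX K m f = w :=
  act_ext m fun a => by rw [act_toWeylX, h]

theorem toWeylX_homog {m : ℕ} {n : ℤ} {d : K[X]} (hd : Preserves m n d) :
    toWeylX K m (homog m n d hd) = mono (sigma K) n d :=
  toWeylX_eq fun _ => rfl

theorem toWeylX_injective (m : ℕ) : Function.Injective (toWeylX K m) := by
  intro f g h
  refine Subtype.ext (LinearMap.ext fun a => Subtype.ext ?_)
  rw [← act_toWeylX, ← act_toWeylX, h]

theorem toWeylX_dToDA (m : ℕ) (d : K[X]) : toWeylX K m (dToDA K m d) = mono (sigma K) 0 d := by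
  have h : (toWeylX K m).comp (dToDA K m).toRingHom = const (sigma K) := by
    refine Polynomial.ringHom_ext (fun a => ?_) ?_
    · refine toWeylX_eq fun b => ?_
      change (((dToDA K m (algebraMap K K[X] a)).1 b : cusp K m) : K[T;T⁻¹]) =
        act K (mono (sigma K) 0 (C a)) b
      rw [AlgHom.commutes, act_mono_C, T_zero, mul_one, ← LaurentPolynomial.smul_eq_C_mul]
      rfl
    · refine toWeylX_eq fun b => ?_
      change (((dToDA K m X).1 b : cusp K m) : K[T;T⁻¹]) = act K (mono (sigma K) 0 X) b
      rw [dToDA, aeval_X, act_mono, T_zero, one_mul, aeval_X]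
      rfl
  exact RingHom.congr_fun h d

theorem homog_mul_dToDA {m : ℕ} {n : ℤ} {d : K[X]} (hd : Preserves m n d) (e : K[X]) :
    homog m n d hd * dToDA K m e = dToDA K m ((sigma K ^ n) e) * homog m n d hd := by
  apply toWeylX_injective
  rw [map_mul, map_mul, toWeylX_homog, toWeylX_dToDA, toWeylX_dToDA, SkewLaurent.mono_mul_mono,
    SkewLaurent.mono_mul_mono, add_zero, zero_add, zpow_zero, mul_comm]
  rfl

/-- A round trip of opposite degrees is an element of `D`, whose action on a weight vector is
governed by the weight alone. This lets information pass from one module to another. -/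
theorem homog_mul_homog {m : ℕ} {n : ℤ} {a b : K[X]} (ha : Preserves m (-n) a)
    (hb : Preserves m n b) :
    homog m (-n) a ha * homog m n b hb = dToDA K m (a * (sigma K ^ (-n)) b) := by
  apply toWeylX_injective
  rw [map_mul, toWeylX_homog, toWeylX_homog, toWeylX_dToDA, SkewLaurent.mono_mul_mono,
    neg_add_cancel]

/-- Different degrees contribute to different powers of `x` in `f(xᵏ)`, so no cancellation between
them can hide a monomial outside `A`. -/
theorem preserves_coeff_toWeylX {m : ℕ} (f : DA K m) (n : ℤ) :
    Preserves m n ((toWeylX K m f).coeff (xp (sigma K) n)) := by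
  intro k hk hkn
  have h := coeff_act_T (toWeylX K m f) k (k + n)
  rw [add_sub_cancel_left] at h
  rw [← h]
  by_contra h0
  refine hkn ((f.1 ⟨T k, T_mem_cusp hk⟩).2 (k + n) ?_)
  rwa [← act_toWeylX]

/-- Every differential operator on the generalized cusp algebra is a sum of homogeneous ones. -/
theorem exists_eq_sum_homog {m : ℕ} (f : DA K m) :
    ∃ (s : Finset ℤ) (d : ℤ → K[X]) (hd : ∀ n, Preserves m n (d n)),
      f = ∑ n ∈ s, homog m n (d n) (hd n) := by
  obtain ⟨s, hs⟩ := SkewLaurent.exists_eq_sum_mono (toWeylX K m f)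
  refine ⟨s, fun n => (toWeylX K m f).coeff (xp (sigma K) n),
    fun n => preserves_coeff_toWeylX f n, ?_⟩
  apply toWeylX_injective
  rw [map_sum]
  simp only [toWeylX_homog]
  exact hs

end Embedding

/-! ### Shifts of maximal ideals and of weight spaces -/

/-- The maximal ideal `σⁿ(𝔭)`. -/
def shift (n : ℤ) (p : MaximalSpectrum K[X]) : MaximalSpectrum K[X] :=
  ⟨p.asIdeal.map (sigma K ^ n), Ideal.map_isMaximal_of_equiv (sigma K ^ n : K[X] ≃+* K[X])⟩

theorem mem_shift {n : ℤ} {p : MaximalSpectrum K[X]} {d : K[X]} :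
    d ∈ (shift n p).asIdeal ↔ ∃ e ∈ p.asIdeal, (sigma K ^ n) e = d :=
  Ideal.mem_map_of_equiv (sigma K ^ n : K[X] ≃+* K[X]) d

theorem mem_orbit_iff {p q : MaximalSpectrum K[X]} : q ∈ orbit p ↔ ∃ n, q = shift n p :=
  exists_congr fun _ => (MaximalSpectrum.ext_iff (y := shift _ p)).symm

theorem shift_zero (p : MaximalSpectrum K[X]) : shift 0 p = p := by
  refine MaximalSpectrum.ext (Ideal.ext fun d => ?_)
  rw [mem_shift]
  simp

theorem shift_shift (i j : ℤ) (p : MaximalSpectrum K[X]) :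
    shift i (shift j p) = shift (i + j) p := by
  refine MaximalSpectrum.ext (Ideal.ext fun d => ?_)
  simp only [mem_shift]
  constructor
  · rintro ⟨_, ⟨e, he, rfl⟩, rfl⟩
    exact ⟨e, he, by rw [zpow_add, RingAut.mul_apply]⟩
  · rintro ⟨e, he, rfl⟩
    exact ⟨_, ⟨e, he, rfl⟩, by rw [zpow_add, RingAut.mul_apply]⟩

theorem orbit_shift (n : ℤ) (p : MaximalSpectrum K[X]) : orbit (shift n p) = orbit p := by
  ext q
  simp only [mem_orbit_iff, shift_shift]
  constructor
  · rintro ⟨i, rfl⟩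
    exact ⟨_, rfl⟩
  · rintro ⟨i, rfl⟩
    exact ⟨i - n, by rw [sub_add_cancel]⟩

theorem self_mem_orbit (p : MaximalSpectrum K[X]) : p ∈ orbit p :=
  mem_orbit_iff.2 ⟨0, (shift_zero p).symm⟩

theorem orbit_eq_of_mem {p q : MaximalSpectrum K[X]} (h : q ∈ orbit p) : orbit q = orbit p := by
  obtain ⟨n, rfl⟩ := mem_orbit_iff.1 h
  exact orbit_shift n p

theorem exists_irreducible_span (p : MaximalSpectrum K[X]) :
    ∃ f : K[X], Irreducible f ∧ p.asIdeal = Ideal.span {f} := by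
  have hp := p.isMaximal
  refine ⟨_, ?_, (Ideal.span_singleton_generator p.asIdeal).symm⟩
  refine (Submodule.IsPrincipal.prime_generator_of_isPrime p.asIdeal ?_).irreducible
  exact Ring.ne_bot_of_isMaximal_of_not_isField hp (Polynomial.not_isField K)

/-- An irreducible generator `f` of `𝔭` is divisible by its translate, which has the same degree and
leading coefficient, so the two agree. If `n ≠ 0`, then `f` is periodic, takes the value `f(0)`
infinitely often and is constant, contradicting irreducibility. -/
theorem eq_zero_of_shift_eq [CharZero K] {p : MaximalSpectrum K[X]} {n : ℤ}
    (h : shift n p = p) : n = 0 := by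
  obtain ⟨f, hf, hpf⟩ := exists_irreducible_span p
  by_contra hn
  have h1 : f.comp (X - C (n : K)) ∣ f := by
    have h2 : f ∈ (shift n p).asIdeal := by
      rw [h, hpf]
      exact Ideal.mem_span_singleton_self f
    obtain ⟨e, he, h3⟩ := mem_shift.1 h2
    rw [hpf, Ideal.mem_span_singleton] at he
    obtain ⟨c, rfl⟩ := he
    rw [map_mul, sigma_zpow_apply] at h3
    exact ⟨_, h3.symm⟩
  have hdeg : (f.comp (X - C (n : K))).natDegree = f.natDegree := by
    rw [natDegree_comp, natDegree_X_sub_C, mul_one]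
  have hlead : (f.comp (X - C (n : K))).leadingCoeff = f.leadingCoeff := by
    rw [leadingCoeff_comp (by rw [natDegree_X_sub_C]; exact one_ne_zero), leadingCoeff_X_sub_C,
      one_pow, mul_one]
  have hcomp : f.comp (X - C (n : K)) = f := by
    refine eq_of_dvd_of_natDegree_le_of_leadingCoeff h1 hdeg.ge hlead
  have hper : ∀ k : ℕ, f.eval (-(n : K) * k) = f.eval 0 := by
    intro k
    induction k with
    | zero => simp
    | succ k ih =>
      rw [← ih]
      conv_rhs => rw [← hcomp]
      rw [eval_comp]
      congr 1
      simp
      ring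
  have hconst : f - C (f.eval 0) = 0 := by
    refine Polynomial.eq_zero_of_infinite_isRoot _
      (Set.Infinite.mono (s := Set.range fun k : ℕ => -(n : K) * k) ?_ ?_)
    · rintro _ ⟨k, rfl⟩
      rw [Set.mem_ofPred_eq, IsRoot, eval_sub, eval_C, hper, sub_self]
    · refine Set.infinite_range_of_injective fun a b hab => ?_
      have hn' : -(n : K) ≠ 0 := neg_ne_zero.2 (by exact_mod_cast hn)
      exact_mod_cast mul_left_cancel₀ hn' hab
  have h0 := hf.natDegree_pos
  rw [sub_eq_zero.1 hconst, natDegree_C] at h0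
  exact lt_irrefl _ h0

theorem shift_injective [CharZero K] (p : MaximalSpectrum K[X]) :
    Function.Injective fun n => shift n p := by
  intro i j h
  have h1 : shift (i - j) (shift j p) = shift j p := by
    rw [shift_shift, sub_add_cancel]
    exact h
  exact sub_eq_zero.1 (eq_zero_of_shift_eq h1)

theorem X_sub_C_mem_shift_hIdeal (n : ℤ) : X - C (n : K) ∈ (shift n (hIdeal K)).asIdeal :=
  mem_shift.2 ⟨X, Ideal.mem_span_singleton_self X, by rw [sigma_zpow_apply, X_comp]⟩

theorem shift_hIdeal_asIdeal (n : ℤ) :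
    (shift n (hIdeal K)).asIdeal = Ideal.span {X - C (n : K)} := by
  change Ideal.map _ (Ideal.span {X}) = _
  rw [Ideal.map_span, Set.image_singleton, sigma_zpow_apply, X_comp]

theorem X_sub_C_mem_iff {p : MaximalSpectrum K[X]} {n : ℤ} :
    X - C (n : K) ∈ p.asIdeal ↔ p = shift n (hIdeal K) := by
  constructor
  · intro h
    refine MaximalSpectrum.ext ((shift n (hIdeal K)).isMaximal.eq_of_le p.isMaximal.ne_top ?_).symm
    rwa [shift_hIdeal_asIdeal, Ideal.span_singleton_le_iff_mem]
  · rintro rfl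
    exact X_sub_C_mem_shift_hIdeal n

section Weights

variable {m : ℕ} {M : Type*} [AddCommGroup M] [Module (DA K m) M]

theorem dToDA_smul_mem_weightSpace {p : MaximalSpectrum K[X]} {v : M}
    (hv : v ∈ weightSpace K m M p) (d : K[X]) : dToDA K m d • v ∈ weightSpace K m M p := by
  intro e he
  rw [← mul_smul, ← map_mul]
  exact hv _ (p.asIdeal.mul_mem_right _ he)

theorem homog_smul_mem_weightSpace [CharZero K] {p : MaximalSpectrum K[X]} {v : M}
    (hv : v ∈ weightSpace K m M p) {n : ℤ} {d : K[X]} (hd : Preserves m n d) :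
    homog m n d hd • v ∈ weightSpace K m M (shift n p) := by
  intro e he
  obtain ⟨e', he', rfl⟩ := mem_shift.1 he
  rw [← mul_smul, ← homog_mul_dToDA, mul_smul, hv _ he', smul_zero]

end Weights

end Homogeneous

/-! ### Weight vectors, supports and torsion. -/

section Weights

variable {K : Type*} [Field K] {m : ℕ}

/-- Chinese remainder theorem: `e` acts as the identity on one weight space and kills finitely many
others, so it serves as a projection. -/
theorem exists_mem_of_pairwise_ne {ι : Type*} {P : ι → MaximalSpectrum K[X]}
    (hP : Function.Injective P) (s : Finset ι) (j : ι) :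
    ∃ e : K[X], e - 1 ∈ (P j).asIdeal ∧ ∀ i ∈ s, i ≠ j → e ∈ (P i).asIdeal := by
  classical
  induction s using Finset.induction_on with
  | empty => exact ⟨1, by simp, by simp⟩
  | insert a s _ ih =>
    obtain ⟨e, he, hs⟩ := ih
    by_cases haj : a = j
    · refine ⟨e, he, fun i hi hij => hs i ?_ hij⟩
      exact (Finset.mem_insert.1 hi).resolve_left fun h => hij (h.trans haj)
    · have hne : (P a).asIdeal ≠ (P j).asIdeal := fun h => haj (hP (MaximalSpectrum.ext h))
      have hcop : IsCoprime (P a).asIdeal (P j).asIdeal :=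
        Ideal.isCoprime_iff_sup_eq.2 ((P a).isMaximal.coprime_of_ne (P j).isMaximal hne)
      obtain ⟨x, hx, y, hy, hxy⟩ := Ideal.isCoprime_iff_exists.1 hcop
      refine ⟨e * x, ?_, fun i hi hij => ?_⟩
      · have : e * x - 1 = x * (e - 1) - y := by linear_combination hxy
        rw [this]
        exact sub_mem (Ideal.mul_mem_left _ _ he) hy
      · rcases Finset.mem_insert.1 hi with rfl | hi
        · exact Ideal.mul_mem_left _ _ hx
        · exact Ideal.mul_mem_right _ _ (hs i hi hij)

variable {M : Type*} [AddCommGroup M] [Module (DA K m) M]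

theorem dToDA_smul_eq_self {p : MaximalSpectrum K[X]} {v : M} (hv : v ∈ weightSpace K m M p)
    {e : K[X]} (he : e - 1 ∈ p.asIdeal) : dToDA K m e • v = v := by
  have h := hv _ he
  rwa [map_sub, map_one, sub_smul, one_smul, sub_eq_zero] at h

/-- The action of `D` on this weight space factors through the field `D/𝔭`. -/
theorem exists_dToDA_smul_eq {p : MaximalSpectrum K[X]} {v : M} (hv : v ∈ weightSpace K m M p)
    {d : K[X]} (hd : d ∉ p.asIdeal) : ∃ e : K[X], dToDA K m e • dToDA K m d • v = v := by
  obtain ⟨e, y, hy, h⟩ := p.isMaximal.exists_inv hd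
  refine ⟨e, ?_⟩
  rw [← mul_smul, ← map_mul]
  refine dToDA_smul_eq_self hv ?_
  rw [← h, sub_add_cancel_left]
  exact neg_mem hy

theorem mem_of_dToDA_smul_eq_zero {p : MaximalSpectrum K[X]} {v : M}
    (hv : v ∈ weightSpace K m M p) (h0 : v ≠ 0) {d : K[X]} (hd : dToDA K m d • v = 0) :
    d ∈ p.asIdeal := by
  by_contra h
  obtain ⟨e, he⟩ := exists_dToDA_smul_eq hv h
  rw [hd, smul_zero] at he
  exact h0 he.symm

theorem eq_of_mem_weightSpace {p q : MaximalSpectrum K[X]} {v : M}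
    (hp : v ∈ weightSpace K m M p) (hq : v ∈ weightSpace K m M q) (h0 : v ≠ 0) : p = q :=
  MaximalSpectrum.ext (p.isMaximal.eq_of_le q.isMaximal.ne_top fun d hd =>
    mem_of_dToDA_smul_eq_zero hq h0 (hp d hd))

open Classical in
/-- The components of a finite sum of weight vectors are obtained by applying elements of `D`. -/
theorem exists_dToDA_smul_sum_eq {ι : Type*} {P : ι → MaximalSpectrum K[X]}
    (hP : Function.Injective P) (s : Finset ι) {w : ι → M}
    (hw : ∀ i ∈ s, w i ∈ weightSpace K m M (P i)) (j : ι) :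
    ∃ e : K[X], e - 1 ∈ (P j).asIdeal ∧
      dToDA K m e • ∑ i ∈ s, w i = if j ∈ s then w j else 0 := by
  obtain ⟨e, he, hs⟩ := exists_mem_of_pairwise_ne hP s j
  refine ⟨e, he, ?_⟩
  have h : ∀ i ∈ s, dToDA K m e • w i = if j = i then w j else 0 := by
    intro i hi
    split_ifs with h
    · rw [h] at he ⊢
      exact dToDA_smul_eq_self (hw i hi) he
    · exact hw i hi _ (hs i hi (Ne.symm h))
  rw [Finset.smul_sum, Finset.sum_congr rfl h, Finset.sum_ite_eq]

theorem mem_supp_iff {p : MaximalSpectrum K[X]} :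
    p ∈ supp K m M ↔ ∃ v ∈ weightSpace K m M p, v ≠ 0 :=
  AddSubgroup.ne_bot_iff_exists_ne_zero.trans
    ⟨fun ⟨v, hv⟩ => ⟨v, v.2, fun h => hv (Subtype.ext h)⟩,
      fun ⟨v, hv, h⟩ => ⟨⟨v, hv⟩, fun h' => h (congrArg Subtype.val h')⟩⟩

theorem supp_subset_of_equiv {N : Type*} [AddCommGroup N] [Module (DA K m) N]
    (f : M ≃ₗ[DA K m] N) : supp K m M ⊆ supp K m N := by
  intro p hp
  obtain ⟨v, hv, h0⟩ := mem_supp_iff.1 hp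
  refine mem_supp_iff.2 ⟨f v, fun d hd => ?_, fun h => h0 (f.map_eq_zero_iff.1 h)⟩
  rw [← map_smul, hv d hd, map_zero]

theorem supp_eq_of_equiv {N : Type*} [AddCommGroup N] [Module (DA K m) N]
    (f : M ≃ₗ[DA K m] N) : supp K m M = supp K m N :=
  (supp_subset_of_equiv f).antisymm (supp_subset_of_equiv f.symm)

/-- Irreducible factors are stripped from `d` as long as the remaining factor still kills `v`; when
it no longer does, it sends `v` to a nonzero vector killed by the last factor removed. -/
theorem exists_mem_supp_of_smul_eq_zero {d : K[X]} (hd : d ≠ 0) {v : M} (hv : v ≠ 0)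
    (hdv : dToDA K m d • v = 0) : ∃ p, p ∈ supp K m M := by
  induction d using WfDvdMonoid.induction_on_irreducible generalizing v with
  | zero => exact absurd rfl hd
  | unit d hd' =>
    obtain ⟨e, he⟩ := hd'.exists_left_inv
    refine absurd ?_ hv
    rw [← one_smul (DA K m) v, ← map_one (dToDA K m), ← he, map_mul, mul_smul, hdv, smul_zero]
  | mul a i ha hi ih =>
    by_cases h : dToDA K m a • v = 0
    · exact ih ha hv h
    · refine ⟨⟨Ideal.span {i}, PrincipalIdealRing.isMaximal_of_irreducible hi⟩,
        mem_supp_iff.2 ⟨_, fun e he => ?_, h⟩⟩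
      obtain ⟨c, rfl⟩ := Ideal.mem_span_singleton.1 he
      rw [← mul_smul, ← map_mul, mul_right_comm, mul_comm, map_mul, mul_smul, hdv, smul_zero]

theorem IsDTorsion.exists_mem_supp [Nontrivial M] (h : IsDTorsion K m M) :
    ∃ p, p ∈ supp K m M := by
  obtain ⟨v, hv⟩ := exists_ne (0 : M)
  obtain ⟨d, hd, hdv⟩ := h v
  exact exists_mem_supp_of_smul_eq_zero hd hv hdv

theorem exists_ne_zero_smul_sum_eq_zero {ι : Type*} (s : Finset ι) {w : ι → M}
    (hw : ∀ i ∈ s, ∃ d : K[X], d ≠ 0 ∧ dToDA K m d • w i = 0) :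
    ∃ d : K[X], d ≠ 0 ∧ dToDA K m d • ∑ i ∈ s, w i = 0 := by
  classical
  induction s using Finset.induction_on with
  | empty => exact ⟨1, one_ne_zero, by simp⟩
  | insert a s ha ih =>
    obtain ⟨d, hd, h⟩ := ih fun i hi => hw i (Finset.mem_insert_of_mem hi)
    obtain ⟨e, he, h'⟩ := hw a (Finset.mem_insert_self a s)
    refine ⟨d * e, mul_ne_zero hd he, ?_⟩
    rw [Finset.sum_insert ha, smul_add, map_mul, mul_smul, h', smul_zero, zero_add, ← map_mul,
      mul_comm, map_mul, mul_smul, h, smul_zero]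

theorem exists_ne_zero_smul_eq_zero {p : MaximalSpectrum K[X]} {v : M}
    (hv : v ∈ weightSpace K m M p) : ∃ d : K[X], d ≠ 0 ∧ dToDA K m d • v = 0 := by
  obtain ⟨f, hf, hp⟩ := exists_irreducible_span p
  exact ⟨f, hf.ne_zero, hv f (hp ▸ Ideal.mem_span_singleton_self f)⟩

theorem IsWeight.isDTorsion (h : IsWeight K m M) : IsDTorsion K m M := by
  classical
  intro v
  obtain ⟨x, rfl⟩ := h.2 v
  rw [DirectSum.coeAddMonoidHom_eq_dfinsuppSum, DFinsupp.sum]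
  exact exists_ne_zero_smul_sum_eq_zero _ fun i _ => exists_ne_zero_smul_eq_zero (x i).2

theorem injective_coeAddMonoidHom_weightSpace [DecidableEq (MaximalSpectrum K[X])] :
    Function.Injective (DirectSum.coeAddMonoidHom (weightSpace K m M)) := by
  classical
  rw [injective_iff_map_eq_zero]
  intro x hx
  rw [DirectSum.coeAddMonoidHom_eq_dfinsuppSum, DFinsupp.sum] at hx
  refine DFinsupp.ext fun p => Subtype.ext ?_
  by_contra hp
  obtain ⟨e, -, he⟩ := exists_dToDA_smul_sum_eq (m := m) (M := M) Function.injective_id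
    (DFinsupp.support x) (w := fun p => (x p : M)) (fun i _ => (x i).2) p
  rw [hx, smul_zero, if_pos (DFinsupp.mem_support_iff.2 fun h => hp (congrArg Subtype.val h))] at he
  exact hp he.symm

theorem not_finiteDimensional_of_infinite_supp [Module K M] [IsScalarTower K (DA K m) M]
    (h : (supp K m M).Infinite) : ¬ FiniteDimensional K M := by
  intro hfin
  choose v hv h0 using fun p : supp K m M => mem_supp_iff.1 p.2
  have hli : LinearIndependent K v := by
    rw [linearIndependent_iff']
    intro s g hg i hi
    -- Scalars act through the constants of `D`, so a multiple of a weight vector keeps its weight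
    -- and the projections of `exists_dToDA_smul_sum_eq` apply.
    have hc : ∀ (c : K) (u : M), c • u = dToDA K m (algebraMap K K[X] c) • u := by
      intro c u
      rw [AlgHom.commutes, algebraMap_smul]
    obtain ⟨e, -, he⟩ := exists_dToDA_smul_sum_eq (m := m) (M := M)
      (P := fun p : supp K m M => p.1) Subtype.val_injective s (w := fun p => g p • v p)
      (fun p _ => by
        rw [hc]
        exact dToDA_smul_mem_weightSpace (hv p) _) i
    rw [hg, smul_zero, if_pos hi] at he
    exact (smul_eq_zero.1 he.symm).resolve_right (h0 i)
  exact h (Set.finite_coe_iff.1 hli.finite)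

/-! ### Simple modules are determined by any one of their weights. -/

section Simple

variable [CharZero K]

theorem exists_eq_sum_weight [IsSimpleModule (DA K m) M] {p : MaximalSpectrum K[X]} {v : M}
    (hv : v ∈ weightSpace K m M p) (h0 : v ≠ 0) (u : M) :
    ∃ (s : Finset ℤ) (w : ℤ → M), (∀ n, w n ∈ weightSpace K m M (shift n p)) ∧
      u = ∑ n ∈ s, w n := by
  obtain ⟨f, rfl⟩ := IsSimpleModule.toSpanSingleton_surjective (DA K m) h0 u
  obtain ⟨s, d, hd, rfl⟩ := exists_eq_sum_homog f
  exact ⟨s, fun n => homog m n (d n) (hd n) • v,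
    fun n => homog_smul_mem_weightSpace hv (hd n), Finset.sum_smul⟩

theorem IsDTorsion.isWeight [IsSimpleModule (DA K m) M] (h : IsDTorsion K m M) :
    IsWeight K m M := by
  classical
  have := IsSimpleModule.nontrivial (DA K m) M
  obtain ⟨p, hp⟩ := h.exists_mem_supp
  obtain ⟨v, hv, h0⟩ := mem_supp_iff.1 hp
  refine ⟨injective_coeAddMonoidHom_weightSpace, fun u => ?_⟩
  obtain ⟨s, w, hw, rfl⟩ := exists_eq_sum_weight hv h0 u
  refine ⟨∑ n ∈ s, DirectSum.of (fun q => weightSpace K m M q) (shift n p) ⟨w n, hw n⟩, ?_⟩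
  simp only [map_sum, DirectSum.coeAddMonoidHom_of]

/-- If `f` kills `v`, so does each homogeneous component `d xⁿ`, because the weights `σⁿ(𝔭)` are
distinct. If `d xⁿ` did not kill `v'`, simplicity of `N` would give some `b x⁻ⁿ` leading back to
`v'`. The product lies in `D` and is `1` modulo `𝔭`, so it would fix `v` as well, although `d xⁿ`
kills `v`. -/
theorem smul_eq_zero_of_smul_eq_zero {N : Type*} [AddCommGroup N] [Module (DA K m) N]
    [IsSimpleModule (DA K m) N] {p : MaximalSpectrum K[X]} {v : M} {v' : N}
    (hv : v ∈ weightSpace K m M p) (h0 : v ≠ 0) (hv' : v' ∈ weightSpace K m N p) (h0' : v' ≠ 0)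
    {f : DA K m} (hf : f • v = 0) : f • v' = 0 := by
  classical
  obtain ⟨s, d, hd, rfl⟩ := exists_eq_sum_homog f
  rw [Finset.sum_smul] at hf ⊢
  refine Finset.sum_eq_zero fun n hn => ?_
  have hnv : homog m n (d n) (hd n) • v = 0 := by
    obtain ⟨e, -, he⟩ := exists_dToDA_smul_sum_eq (shift_injective p) s
      (fun n _ => homog_smul_mem_weightSpace hv (hd n)) n
    rw [hf, smul_zero, if_pos hn] at he
    exact he.symm
  by_contra hnv'
  obtain ⟨g, hg⟩ := IsSimpleModule.toSpanSingleton_surjective (DA K m) hnv' v'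
  obtain ⟨t, b, hb, rfl⟩ := exists_eq_sum_homog g
  rw [LinearMap.toSpanSingleton_apply, Finset.sum_smul] at hg
  -- Only the component of `g` of degree `-n` can land in weight `𝔭`, so it alone already returns to
  -- `v'`. If `-n ∉ t`, this would make `v'` zero.
  obtain ⟨e, he1, he⟩ := exists_dToDA_smul_sum_eq (shift_injective (shift n p)) t
    (fun k _ => homog_smul_mem_weightSpace (homog_smul_mem_weightSpace hv' (hd n)) (hb k)) (-n)
  simp only [shift_shift, neg_add_cancel, shift_zero] at he1
  rw [hg, dToDA_smul_eq_self hv' he1] at he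
  split_ifs at he
  · rw [← mul_smul, homog_mul_homog] at he
    have h1 : b (-n) * (sigma K ^ (-n)) (d n) - 1 ∈ p.asIdeal := by
      refine mem_of_dToDA_smul_eq_zero hv' h0' ?_
      rw [map_sub, map_one, sub_smul, one_smul, ← he, sub_self]
    have h2 := dToDA_smul_eq_self hv h1
    rw [← homog_mul_homog (hb _) (hd n), mul_smul, hnv, smul_zero] at h2
    exact h0 h2.symm
  · exact h0' he

/-- Simple modules with a common weight are isomorphic. -/
theorem nonempty_equiv_of_mem_supp {N : Type*} [AddCommGroup N] [Module (DA K m) N]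
    [IsSimpleModule (DA K m) M] [IsSimpleModule (DA K m) N] {p : MaximalSpectrum K[X]}
    (hM : p ∈ supp K m M) (hN : p ∈ supp K m N) : Nonempty (M ≃ₗ[DA K m] N) := by
  obtain ⟨v, hv, h0⟩ := mem_supp_iff.1 hM
  obtain ⟨v', hv', h0'⟩ := mem_supp_iff.1 hN
  have hker : LinearMap.ker (LinearMap.toSpanSingleton (DA K m) M v) =
      LinearMap.ker (LinearMap.toSpanSingleton (DA K m) N v') := by
    ext f
    exact ⟨fun h => smul_eq_zero_of_smul_eq_zero hv h0 hv' h0' h,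
      fun h => smul_eq_zero_of_smul_eq_zero hv' h0' hv h0 h⟩
  exact ⟨((LinearMap.quotKerEquivOfSurjective _
      (IsSimpleModule.toSpanSingleton_surjective (DA K m) h0)).symm.trans
    (Submodule.quotEquivOfEq _ _ hker)).trans (LinearMap.quotKerEquivOfSurjective _
      (IsSimpleModule.toSpanSingleton_surjective (DA K m) h0'))⟩

/-- A criterion of simplicity for modules spanned over `D` by vectors of weights `σʲ(𝔭)`. -/
theorem isSimpleModule_of_weight_family {p : MaximalSpectrum K[X]} {J : Set ℤ} (hJ : J.Nonempty)
    {u : ℤ → M} (hu : ∀ j ∈ J, u j ∈ weightSpace K m M (shift j p)) (h0 : ∀ j ∈ J, u j ≠ 0)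
    (htrans : ∀ j ∈ J, ∀ k ∈ J, ∃ f : DA K m, f • u j = u k)
    (hspan : ∀ x : M, ∃ (s : Finset ℤ) (d : ℤ → K[X]), ↑s ⊆ J ∧
      x = ∑ j ∈ s, dToDA K m (d j) • u j) :
    IsSimpleModule (DA K m) M ∧ IsDTorsion K m M ∧ supp K m M = (fun j => shift j p) '' J := by
  -- Every nonzero `x` yields some `u j` under `D` alone: a nonzero component is isolated, and its
  -- coefficient is then inverted modulo the weight.
  have hred : ∀ x : M, x ≠ 0 → ∃ j ∈ J, ∃ e : K[X], dToDA K m e • x = u j := by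
    intro x hx
    obtain ⟨s, d, hs, rfl⟩ := hspan x
    obtain ⟨j, hj, hj0⟩ := Finset.exists_ne_zero_of_sum_ne_zero hx
    obtain ⟨e, -, he⟩ := exists_dToDA_smul_sum_eq (shift_injective p) s
      (fun n hn => dToDA_smul_mem_weightSpace (hu n (hs hn)) (d n)) j
    rw [if_pos hj] at he
    obtain ⟨e', he'⟩ := exists_dToDA_smul_eq (hu j (hs hj)) (d := d j)
      fun h => hj0 (hu j (hs hj) _ h)
    refine ⟨j, hs hj, e' * e, ?_⟩
    rw [map_mul, mul_smul, he, he']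
  refine ⟨?_, ?_, ?_⟩
  · rw [isSimpleModule_iff_toSpanSingleton_surjective]
    obtain ⟨j, hj⟩ := hJ
    refine ⟨nontrivial_of_ne _ _ (h0 j hj), fun x hx y => ?_⟩
    obtain ⟨i, hi, e, he⟩ := hred x hx
    choose f hf using fun k : J => htrans i hi k k.2
    obtain ⟨s, d, hs, rfl⟩ := hspan y
    -- From `x` to `u i` by `e`, from `u i` to each `u k` by a transition operator, then the
    -- coefficients of `y`.
    refine ⟨∑ k ∈ s.attach, dToDA K m (d k) * (f ⟨k, hs k.2⟩ * dToDA K m e), ?_⟩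
    rw [LinearMap.toSpanSingleton_apply, Finset.sum_smul, ← Finset.sum_attach s]
    refine Finset.sum_congr rfl fun k _ => ?_
    rw [mul_smul, mul_smul, he, hf]
  · intro x
    obtain ⟨s, d, hs, rfl⟩ := hspan x
    exact exists_ne_zero_smul_sum_eq_zero s fun j hj =>
      exists_ne_zero_smul_eq_zero (dToDA_smul_mem_weightSpace (hu j (hs hj)) (d j))
  · ext q
    constructor
    · intro hq
      obtain ⟨v, hv, hv0⟩ := mem_supp_iff.1 hq
      obtain ⟨j, hj, e, he⟩ := hred v hv0
      refine ⟨j, hj, eq_of_mem_weightSpace (hu j hj) ?_ (h0 j hj)⟩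
      rw [← he]
      exact dToDA_smul_mem_weightSpace hv e
    · rintro ⟨j, hj, rfl⟩
      exact mem_supp_iff.2 ⟨u j, hu j hj, h0 j hj⟩

end Simple

end Weights

/-! ### Transition operators between weights. -/

section Transitions

variable {K : Type*} [Field K] (m : ℕ)

/-- For each `n`, some `d xⁿ` is a differential operator on `A`, with `d` vanishing only
where it has to. -/
theorem exists_preserves (n : ℤ) : ∃ d ∈ shiftMonoid K, Preserves m n d ∧
    ∀ [CharZero K], ∀ l : ℤ, (l ∈ expts m ∨ l - n ∉ expts m) → d.eval ((l : K) + 1) ≠ 0 := by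
  classical
  -- The roots are `l + 1` for the exponents `l` outside `A` reached from `A` by `xⁿ`. Such `l`
  -- satisfy `l - n ≥ 0` and `l < m`, so the interval loses none of them.
  refine ⟨∏ l ∈ (Finset.Ico n m).filter (fun l => l ∉ expts m ∧ l - n ∈ expts m),
    (X - C ((l + 1 : ℤ) : K)), ?_, ?_, ?_⟩
  · exact prod_mem fun l _ => Submonoid.subset_closure ⟨l + 1, rfl⟩
  · intro k hk hkn
    rw [eval_prod]
    refine Finset.prod_eq_zero (i := k + n) ?_ (by simp)
    refine Finset.mem_filter.2 ⟨?_, hkn, by rwa [add_sub_cancel_right]⟩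
    simp only [expts, Set.mem_ofPred_eq, Finset.mem_Ico] at hk hkn ⊢
    omega
  · intro _ l hl h
    rw [eval_prod, Finset.prod_eq_zero_iff] at h
    obtain ⟨k, hk, h⟩ := h
    have hkl : l = k := by
      rw [eval_sub, eval_X, eval_C, sub_eq_zero] at h
      have h' : l + 1 = k + 1 := by exact_mod_cast h
      exact add_right_cancel h'
    subst hkl
    obtain ⟨h1, h2⟩ := (Finset.mem_filter.1 hk).2
    exact hl.elim h1 fun h => h h2

theorem eval_eq_zero_of_mem_shift {j : ℤ} {d : K[X]}
    (hd : d ∈ (shift j (hIdeal K)).asIdeal) : d.eval (j : K) = 0 := by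
  rw [shift_hIdeal_asIdeal, Ideal.mem_span_singleton] at hd
  exact dvd_iff_isRoot.1 hd

end Transitions

/-! ### The modules `A` and `A' = L/A` and the orbit of `(h)`. -/

section Laurent

variable {K : Type*} [Field K] [CharZero K] {m : ℕ}

/-- The inclusion `A → L` as a homomorphism of `𝒟(A)`-modules. -/
def cuspToL (m : ℕ) : cusp K m →ₗ[DA K m] LMod K m where
  toFun a := (a : K[T;T⁻¹])
  map_add' _ _ := rfl
  map_smul' f a := (act_toWeylX f a).symm

theorem cuspToL_injective : Function.Injective (cuspToL (K := K) m) := Subtype.val_injective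

/-- The element `xⁱ` of `L`. -/
def xL (m : ℕ) (i : ℤ) : LMod K m := (T i : K[T;T⁻¹])

theorem homog_smul_xL {n : ℤ} {d : K[X]} (hd : Preserves m n d) (i : ℤ) :
    homog m n d hd • xL (K := K) m i =
      dToDA K m (C (d.eval (((n + i : ℤ) : K) + 1))) • xL m (n + i) := by
  change act K (toWeylX K m _) (T i) = act K (toWeylX K m _) (T (n + i))
  rw [toWeylX_homog, toWeylX_dToDA, act_mono_T, act_mono_T, eval_C, zero_add]

theorem dToDA_smul_xL (d : K[X]) (i : ℤ) :
    dToDA K m d • xL (K := K) m i = dToDA K m (C (d.eval ((i : K) + 1))) • xL m i := by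
  change act K (toWeylX K m _) (T i) = act K (toWeylX K m _) (T i)
  rw [toWeylX_dToDA, toWeylX_dToDA, act_mono_T, act_mono_T, eval_C, zero_add]

/-- The eigenvalue of `h` on `xʲ⁻¹` is `j`; indexing by weight instead of exponent causes the shift
by one in the families below. -/
theorem xL_mem_weightSpace (j : ℤ) :
    xL m (j - 1) ∈ weightSpace K m (LMod K m) (shift j (hIdeal K)) := by
  intro d hd
  rw [dToDA_smul_xL, Int.cast_sub, Int.cast_one, sub_add_cancel, eval_eq_zero_of_mem_shift hd,
    C_0, map_zero, zero_smul]

/-- The only excluded move is from inside `A` to outside. Otherwise the minimal `d` of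
`exists_preserves` does not vanish at `k + 1`, and the scalar obtained can be inverted. -/
theorem exists_smul_xL_eq {i k : ℤ} (h : k ∈ expts m ∨ i ∉ expts m) :
    ∃ f : DA K m, f • xL (K := K) m i = xL m k := by
  obtain ⟨d, -, hd, hne⟩ := exists_preserves (K := K) m (k - i)
  refine ⟨dToDA K m (C (d.eval ((k : K) + 1))⁻¹) * homog m _ d hd, ?_⟩
  rw [mul_smul, homog_smul_xL, sub_add_cancel, ← mul_smul, ← map_mul, ← C_mul,
    inv_mul_cancel₀ (hne k (by rwa [sub_sub_cancel])), C_1, map_one, one_smul]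

theorem eq_sum_smul_xL (f : K[T;T⁻¹]) :
    (f : LMod K m) = ∑ j ∈ f.coeff.support.map (addRightEmbedding 1),
      dToDA K m (C (f.coeff (j - 1))) • xL m (j - 1) := by
  rw [Finset.sum_map]
  have h : ∀ i : ℤ, dToDA K m (C (f.coeff i)) • xL (K := K) m i =
      (AddMonoidAlgebra.single i (f.coeff i) : K[T;T⁻¹]) := by
    intro i
    change act K (toWeylX K m _) (T i) = _
    rw [toWeylX_dToDA, act_mono_C, T_zero, mul_one, LaurentPolynomial.single_eq_C_mul_T]
  simp only [addRightEmbedding_apply, add_sub_cancel_right, h]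
  exact f.sum_coeff_single.symm

theorem mk_xL_eq_zero_iff {i : ℤ} :
    (cuspInL K m).mkQ (xL m i) = 0 ↔ i ∈ expts m := by
  rw [Submodule.mkQ_apply, Submodule.Quotient.mk_eq_zero]
  refine ⟨fun h => h i ?_, fun h => T_mem_cusp h⟩
  rw [xL, coeff_T, if_pos rfl]
  exact one_ne_zero

variable (K m)

local instance : AddCommGroup (ComplMod K m) := Submodule.Quotient.addCommGroup (cuspInL K m)

local instance : Module (DA K m) (ComplMod K m) := Submodule.Quotient.module (cuspInL K m)

/-- The weights of `A` are `hxⁱ = (i + 1) xⁱ`, where `xⁱ ∈ A`. -/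
theorem cusp_simple_torsion_supp : IsSimpleModule (DA K m) (cusp K m) ∧
    IsDTorsion K m (cusp K m) ∧
    supp K m (cusp K m) = (fun j => shift j (hIdeal K)) '' {j | j - 1 ∈ expts m} := by
  classical
  set u : ℤ → cusp K m := fun j =>
    if h : j - 1 ∈ expts m then ⟨T (j - 1), T_mem_cusp h⟩ else 0 with hu_def
  have hu : ∀ j, j - 1 ∈ expts m → cuspToL m (u j) = xL m (j - 1) := by
    intro j hj
    simp only [hu_def, dif_pos hj]
    rfl
  -- The index `1` is the weight of `x⁰`. The default value `0` of `u` lies outside the index set.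
  refine isSimpleModule_of_weight_family (u := u) ⟨1, by left; simp⟩ ?_ ?_ ?_ ?_
  · intro j hj d hd
    refine cuspToL_injective ?_
    rw [map_smul, hu j hj, xL_mem_weightSpace j d hd, map_zero]
  · intro j hj h0
    have h := hu j hj
    rw [h0, map_zero] at h
    have h' := congrArg (fun f : K[T;T⁻¹] => f.coeff (j - 1)) h
    simp only [xL, coeff_T, if_pos] at h'
    exact zero_ne_one h'
  · intro j hj k hk
    obtain ⟨f, hf⟩ := exists_smul_xL_eq (K := K) (i := j - 1) (Or.inl hk)
    exact ⟨f, cuspToL_injective (by rw [map_smul, hu j hj, hu k hk, hf])⟩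
  · intro x
    have hs : ↑(x.1.coeff.support.map (addRightEmbedding 1)) ⊆ {j : ℤ | j - 1 ∈ expts m} := by
      intro j hj
      obtain ⟨i, hi, rfl⟩ := Finset.mem_map.1 (Finset.mem_coe.1 hj)
      have := x.2 i (Finsupp.mem_support_iff.1 hi)
      rwa [Set.mem_ofPred_eq, addRightEmbedding_apply, add_sub_cancel_right]
    refine ⟨_, fun j => C (x.1.coeff (j - 1)), hs, cuspToL_injective ?_⟩
    rw [map_sum]
    refine (eq_sum_smul_xL x.1).trans (Finset.sum_congr rfl fun j hj => ?_)
    rw [map_smul, hu j (hs hj)]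

theorem complMod_simple_torsion_supp : IsSimpleModule (DA K m) (ComplMod K m) ∧
    IsDTorsion K m (ComplMod K m) ∧
    supp K m (ComplMod K m) = (fun j => shift j (hIdeal K)) '' {j | j - 1 ∉ expts m} := by
  classical
  -- The index `0` is the weight of `x⁻¹`, which is never in `A`.
  refine isSimpleModule_of_weight_family (u := fun j => (cuspInL K m).mkQ (xL m (j - 1)))
    ⟨0, by simp [expts]⟩ ?_ ?_ ?_ ?_
  · intro j _ d hd
    rw [← LinearMap.map_smul, xL_mem_weightSpace j d hd, map_zero]
  · intro j hj h0
    exact hj (mk_xL_eq_zero_iff.1 h0)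
  · intro j hj k hk
    obtain ⟨f, hf⟩ := exists_smul_xL_eq (K := K) (k := k - 1) (Or.inr hj)
    exact ⟨f, by rw [← LinearMap.map_smul, hf]⟩
  · intro x
    obtain ⟨f, rfl⟩ := (cuspInL K m).mkQ_surjective x
    refine ⟨((f : K[T;T⁻¹]).coeff.support.map (addRightEmbedding 1)).filter
      (fun j => j - 1 ∉ expts m), fun j => C ((f : K[T;T⁻¹]).coeff (j - 1)), ?_, ?_⟩
    rotate_left
    · refine (congrArg (cuspInL K m).mkQ (eq_sum_smul_xL f)).trans ?_
      rw [map_sum]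
      simp only [LinearMap.map_smul]
      rw [Finset.sum_filter_of_ne]
      intro j _ h hj
      rw [mk_xL_eq_zero_iff.2 hj, smul_zero] at h
      exact h rfl
    · intro j hj
      exact (Finset.mem_filter.1 (Finset.mem_coe.1 hj)).2

theorem supp_cusp_infinite : (supp K m (cusp K m)).Infinite := by
  rw [(cusp_simple_torsion_supp K m).2.2]
  refine Set.Infinite.image (shift_injective _).injOn (Set.Infinite.mono (s := Set.Ici ((m : ℤ) + 1)) ?_
    (Set.Ici_infinite _))
  intro j hj
  have : (m : ℤ) + 1 ≤ j := hj
  exact Or.inr (by omega)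

theorem supp_complMod_infinite : (supp K m (ComplMod K m)).Infinite := by
  rw [(complMod_simple_torsion_supp K m).2.2]
  refine Set.Infinite.image (shift_injective _).injOn (Set.Infinite.mono (s := Set.Iic 0) ?_
    (Set.Iic_infinite _))
  intro j hj
  have : j ≤ 0 := hj
  simp only [expts, Set.mem_ofPred_eq]
  omega

theorem isEmpty_cusp_equiv_complMod : IsEmpty (cusp K m ≃ₗ[DA K m] ComplMod K m) := by
  refine ⟨fun f => ?_⟩
  have h := supp_eq_of_equiv f
  rw [(cusp_simple_torsion_supp K m).2.2, (complMod_simple_torsion_supp K m).2.2,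
    (shift_injective _).image_injective.eq_iff] at h
  have h1 : (1 : ℤ) ∈ {j | j - 1 ∈ expts m} := Or.inl (sub_self 1)
  exact (h ▸ h1 : (1 : ℤ) ∈ {j | j - 1 ∉ expts m}) h1

variable {K m}

/-- The supports of `A` and `A'` together cover the orbit of `(h)`, so `M` shares a weight with one
of the two. -/
theorem equiv_cusp_or_complMod {M : Type*} [AddCommGroup M] [Module (DA K m) M]
    [IsSimpleModule (DA K m) M] {p : MaximalSpectrum K[X]} (hp : p ∈ supp K m M)
    (h : p ∈ orbit (hIdeal K)) :
    Nonempty (M ≃ₗ[DA K m] cusp K m) ∨ Nonempty (M ≃ₗ[DA K m] ComplMod K m) := by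
  obtain ⟨j, rfl⟩ := mem_orbit_iff.1 h
  have := (cusp_simple_torsion_supp K m).1
  have := (complMod_simple_torsion_supp K m).1
  by_cases hj : j - 1 ∈ expts m
  · refine Or.inl (nonempty_equiv_of_mem_supp hp ?_)
    rw [(cusp_simple_torsion_supp K m).2.2]
    exact ⟨j, hj, rfl⟩
  · refine Or.inr (nonempty_equiv_of_mem_supp hp ?_)
    rw [(complMod_simple_torsion_supp K m).2.2]
    exact ⟨j, hj, rfl⟩

end Laurent

/-! ### Restriction of `𝔹`-modules to `𝒟(A)`, and the other orbits. -/

section BModules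

theorem SkewLaurent.mono_eq_const_mul {R : Type*} [CommRing R] (τ : RingAut R) (n : ℤ) (r : R) :
    mono τ n r = const τ r * mono τ n 1 := by
  change mono τ n r = mono τ 0 r * mono τ n 1
  rw [SkewLaurent.mono_mul_mono, map_one, mul_one, zero_add]

theorem SkewLaurent.coeff_mul_const {R : Type*} [CommRing R] {τ : RingAut R} (b : SkewLaurent τ)
    (r : R) : (b * const τ r).coeff (xp τ 0) = b.coeff (xp τ 0) * r := by
  induction b using SkewLaurent.induction_mono with
  | zero => simp
  | add f g hf hg => rw [add_mul, SkewMonoidAlgebra.coeff_add, SkewMonoidAlgebra.coeff_add,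
      Finsupp.add_apply, Finsupp.add_apply, hf, hg, add_mul]
  | mono n a =>
    change (mono τ n a * mono τ 0 r).coeff _ = _
    rw [SkewLaurent.mono_mul_mono, add_zero, SkewLaurent.coeff_mono, SkewLaurent.coeff_mono]
    split_ifs with h
    · subst h
      rw [zpow_zero]
      rfl
    · rw [zero_mul]

variable {K : Type*} [Field K]

theorem weylXToB_mono (n : ℤ) (d : K[X]) :
    weylXToB K (mono (sigma K) n d) = mono (sigmaT K) n (algebraMap K[X] (TinvD K) d) := by
  have h : weylXToB K (mono (sigma K) n d) = dToB K d * mono (sigmaT K) n 1 :=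
    SkewMonoidAlgebra.liftNC_single _ _ _ _
  rw [h, SkewLaurent.mono_eq_const_mul (sigmaT K) n (algebraMap K[X] (TinvD K) d)]
  rfl

theorem shiftMonoid_le_nonZeroDivisors : shiftMonoid K ≤ nonZeroDivisors K[X] := by
  rw [shiftMonoid, Submonoid.closure_le]
  rintro _ ⟨i, rfl⟩
  exact mem_nonZeroDivisors_of_ne_zero (X_sub_C_ne_zero _)

theorem notMem_of_mem_shiftMonoid [CharZero K] {p : MaximalSpectrum K[X]}
    (hp : p ∉ orbit (hIdeal K)) {t : K[X]} (ht : t ∈ shiftMonoid K) : t ∉ p.asIdeal := by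
  have := p.isMaximal.isPrime
  induction ht using Submonoid.closure_induction with
  | mem t ht =>
    obtain ⟨i, rfl⟩ := ht
    exact fun h => hp (mem_orbit_iff.2 ⟨i, X_sub_C_mem_iff.1 h⟩)
  | one => exact p.asIdeal.one_notMem
  | mul a b _ _ ha hb => exact fun h => (this.mem_or_mem h).elim ha hb

variable [CharZero K] {m : ℕ} {N : Type*} [AddCommGroup N] [Module (BRing K) N]

local instance : Module (BRing K) (Res m N) := inferInstanceAs (Module (BRing K) N)

theorem homog_smul_res {n : ℤ} {d : K[X]} (hd : Preserves m n d) (v : Res m N) :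
    homog m n d hd • v = mono (sigmaT K) n (algebraMap K[X] (TinvD K) d) • v := by
  rw [← weylXToB_mono, ← toWeylX_homog hd]
  rfl

theorem dToDA_smul_res (d : K[X]) (v : Res m N) :
    dToDA K m d • v = const (sigmaT K) (algebraMap K[X] (TinvD K) d) • v := by
  change _ = mono (sigmaT K) 0 _ • v
  rw [← weylXToB_mono, ← toWeylX_dToDA m]
  rfl

theorem dToDA_smul_const_mk'_smul (a : K[X]) (t : shiftMonoid K) (v : Res m N) :
    dToDA K m t • const (sigmaT K) (IsLocalization.mk' (TinvD K) a t) • v = dToDA K m a • v := by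
  rw [dToDA_smul_res, dToDA_smul_res, ← mul_smul, ← map_mul, IsLocalization.mk'_spec']

/-- Elements of `T` are units of `𝔹`. Identities over `𝔹` can thus be checked after clearing
denominators, where they become identities over `𝒟(A)`. -/
theorem smul_left_cancel_of_mem_shiftMonoid {t : K[X]} (ht : t ∈ shiftMonoid K) {v w : Res m N}
    (h : dToDA K m t • v = dToDA K m t • w) : v = w := by
  have h1 : ∀ u : Res m N, const (sigmaT K) (IsLocalization.mk' (TinvD K) 1 ⟨t, ht⟩) •
      dToDA K m t • u = u := by
    intro u
    rw [dToDA_smul_res, ← mul_smul, ← map_mul]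
    have := IsLocalization.mk'_spec (TinvD K) (1 : K[X]) (⟨t, ht⟩ : shiftMonoid K)
    rw [this, map_one, map_one, one_smul]
  rw [← h1 v, h, h1]

theorem dToDA_smul_mono_smul {n : ℤ} {d : K[X]} (hd : Preserves m n d) (v : Res m N) :
    dToDA K m d • mono (sigmaT K) n 1 • v = homog m n d hd • v := by
  rw [homog_smul_res, dToDA_smul_res, ← mul_smul, ← SkewLaurent.mono_eq_const_mul]

/-- Homomorphisms over `𝒟(A)` between `𝔹`-modules are homomorphisms over `𝔹`. -/
theorem map_BRing_smul {N' : Type*} [AddCommGroup N'] [Module (BRing K) N']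
    (f : Res m N →ₗ[DA K m] Res m N') (b : BRing K) (v : Res m N) : f (b • v) = b • f v := by
  have hconst : ∀ (c : TinvD K) (v : Res m N),
      f (const (sigmaT K) c • v) = const (sigmaT K) c • f v := by
    intro c v
    obtain ⟨a, t, rfl⟩ := IsLocalization.exists_mk'_eq (shiftMonoid K) c
    refine smul_left_cancel_of_mem_shiftMonoid t.2 ?_
    rw [← map_smul, dToDA_smul_const_mk'_smul, dToDA_smul_const_mk'_smul, map_smul]
  have hx : ∀ n : ℤ, f (mono (sigmaT K) n 1 • v) = mono (sigmaT K) n 1 • f v := by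
    intro n
    -- The element `xⁿ` may fail to preserve `A`, but `d xⁿ` lies in `𝒟(A)` for some `d ∈ T`, and
    -- `d` can be cancelled.
    obtain ⟨d, hd, hp, -⟩ := exists_preserves (K := K) m n
    refine smul_left_cancel_of_mem_shiftMonoid hd ?_
    rw [← map_smul, dToDA_smul_mono_smul hp, dToDA_smul_mono_smul hp, map_smul]
  induction b using SkewLaurent.induction_mono with
  | zero => rw [zero_smul, zero_smul, map_zero]
  | add a b ha hb => rw [add_smul, add_smul, map_add, ha, hb]
  | mono n c => rw [SkewLaurent.mono_eq_const_mul, mul_smul, mul_smul, hconst, hx]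

theorem mono_smul_mem_weightSpace {p : MaximalSpectrum K[X]} {v : Res m N}
    (hv : v ∈ weightSpace K m (Res m N) p) (n : ℤ) :
    mono (sigmaT K) n 1 • v ∈ weightSpace K m (Res m N) (shift n p) := by
  intro d hd
  obtain ⟨e, he, rfl⟩ := mem_shift.1 hd
  have h : const (sigmaT K) (algebraMap K[X] (TinvD K) ((sigma K ^ n) e)) * mono (sigmaT K) n 1 =
      mono (sigmaT K) n 1 * const (sigmaT K) (algebraMap K[X] (TinvD K) e) := by
    rw [← SkewLaurent.mono_eq_const_mul, ← sigmaT_zpow_algebraMap]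
    change _ = mono (sigmaT K) n 1 * mono (sigmaT K) 0 _
    rw [SkewLaurent.mono_mul_mono, one_mul, add_zero]
  rw [dToDA_smul_res, ← mul_smul, h, mul_smul, ← dToDA_smul_res, hv e he, smul_zero]

/-- Denominators are invertible modulo `𝔭`, so a fraction acts on `v` as a polynomial does. -/
theorem exists_const_smul_eq {p : MaximalSpectrum K[X]} (hp : p ∉ orbit (hIdeal K)) {v : Res m N}
    (hv : v ∈ weightSpace K m (Res m N) p) (c : TinvD K) :
    ∃ d : K[X], const (sigmaT K) c • v = dToDA K m d • v := by
  obtain ⟨a, t, rfl⟩ := IsLocalization.exists_mk'_eq (shiftMonoid K) c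
  obtain ⟨e, he⟩ := exists_dToDA_smul_eq hv (notMem_of_mem_shiftMonoid hp t.2)
  refine ⟨a * e, smul_left_cancel_of_mem_shiftMonoid t.2 ?_⟩
  rw [dToDA_smul_const_mk'_smul, ← mul_smul, ← map_mul, mul_comm, mul_assoc, map_mul, map_mul,
    mul_smul, mul_smul, he]

/-- The vectors `xʲ v` form the weight family. Passing from `xʲ v` to `xᵏ v` uses some `d xᵏ⁻ʲ` in
`𝒟(A)` with `d ∈ T`; since the orbit avoids that of `(h)`, `d` is invertible on the target weight
space. -/
theorem isSimpleModule_res {p : MaximalSpectrum K[X]} (hp : p ∉ orbit (hIdeal K)) {v : Res m N}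
    (hv : v ∈ weightSpace K m (Res m N) p) (h0 : v ≠ 0)
    (hspan : ∀ u : Res m N, ∃ b : BRing K, b • v = u) :
    IsSimpleModule (DA K m) (Res m N) ∧ IsDTorsion K m (Res m N) ∧
      supp K m (Res m N) = orbit p := by
  have hmem : ∀ j, shift j p ∉ orbit (hIdeal K) := by
    intro j h
    refine hp ?_
    rw [← orbit_eq_of_mem h, orbit_shift]
    exact self_mem_orbit p
  have hmul : ∀ (i j : ℤ) (u : Res m N),
      mono (sigmaT K) i 1 • mono (sigmaT K) j 1 • u = mono (sigmaT K) (i + j) 1 • u := by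
    intro i j u
    rw [← mul_smul, SkewLaurent.mono_mul_mono, map_one, mul_one]
  have horb : orbit p = (fun j => shift j p) '' Set.univ := by
    ext q
    rw [mem_orbit_iff, Set.image_univ]
    exact exists_congr fun _ => eq_comm
  rw [horb]
  refine isSimpleModule_of_weight_family (u := fun j => mono (sigmaT K) j 1 • v)
    Set.univ_nonempty (fun j _ => mono_smul_mem_weightSpace hv j) ?_ ?_ ?_
  · intro j _ h
    -- The vector `xʲ v` is nonzero because `x⁻ʲ` undoes `xʲ` over `𝔹`.
    have h1 := hmul (-j) j v
    rw [neg_add_cancel, h, smul_zero] at h1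
    exact h0 (h1.trans (one_smul (BRing K) v)).symm
  · intro j _ k _
    obtain ⟨d, hd, hpres, -⟩ := exists_preserves (K := K) m (k - j)
    obtain ⟨e, he⟩ := exists_dToDA_smul_eq (mono_smul_mem_weightSpace hv k)
      (notMem_of_mem_shiftMonoid (hmem k) hd)
    refine ⟨dToDA K m e * homog m _ d hpres, ?_⟩
    rw [mul_smul, homog_smul_res, SkewLaurent.mono_eq_const_mul, mul_smul, hmul, sub_add_cancel,
      ← dToDA_smul_res, he]
  · intro u
    obtain ⟨b, rfl⟩ := hspan u
    obtain ⟨s, hs⟩ := SkewLaurent.exists_eq_sum_mono b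
    choose d hd using fun n =>
      exists_const_smul_eq (hmem n) (mono_smul_mem_weightSpace hv n) (b.coeff (xp (sigmaT K) n))
    refine ⟨s, d, Set.subset_univ _, ?_⟩
    conv_lhs => rw [hs]
    rw [Finset.sum_smul]
    refine Finset.sum_congr rfl fun n _ => ?_
    rw [SkewLaurent.mono_eq_const_mul, mul_smul, hd]

/-- The generator `h - j` of such a weight would kill a nonzero vector, yet it is a unit of `𝔹`. -/
theorem notMem_orbit_hIdeal_of_mem_supp_res {p : MaximalSpectrum K[X]} (hp : p ∈ supp K m (Res m N)) :
    p ∉ orbit (hIdeal K) := by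
  intro h
  obtain ⟨j, rfl⟩ := mem_orbit_iff.1 h
  obtain ⟨v, hv, h0⟩ := mem_supp_iff.1 hp
  have ht : X - C (j : K) ∈ shiftMonoid K := Submonoid.subset_closure ⟨j, rfl⟩
  refine h0 (smul_left_cancel_of_mem_shiftMonoid ht ?_)
  rw [smul_zero]
  exact hv _ (X_sub_C_mem_shift_hIdeal j)

theorem isDTorsion_res (h : IsTinvDTorsion K N) : IsDTorsion K m (Res m N) := by
  intro v
  obtain ⟨c, hc, hv⟩ : ∃ c : TinvD K, c ≠ 0 ∧ const (sigmaT K) c • v = 0 := h v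
  obtain ⟨a, t, rfl⟩ := IsLocalization.exists_mk'_eq (shiftMonoid K) c
  refine ⟨a, ?_, ?_⟩
  · rintro rfl
    exact hc (IsLocalization.mk'_zero t)
  · rw [← dToDA_smul_const_mk'_smul a t v]
    rw [hv, smul_zero]

theorem isTinvDTorsion_of_res (h : IsDTorsion K m (Res m N)) : IsTinvDTorsion K N := by
  intro v
  obtain ⟨d, hd, hv⟩ := h v
  refine ⟨algebraMap K[X] (TinvD K) d, fun h0 => hd ?_, ?_⟩
  · exact IsLocalization.injective (TinvD K) shiftMonoid_le_nonZeroDivisors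
      (h0.trans (map_zero _).symm)
  · exact (dToDA_smul_res d (N := N) (m := m) v).symm.trans hv

theorem isSimpleModule_of_res (h : IsSimpleModule (DA K m) (Res m N)) :
    IsSimpleModule (BRing K) N := by
  rw [isSimpleModule_iff_toSpanSingleton_surjective] at h ⊢
  refine ⟨h.1, fun v hv u => ?_⟩
  obtain ⟨f, hf⟩ := h.2 v hv u
  exact ⟨daToB K m f, hf⟩

/-- The restriction of a simple torsion `𝔹`-module to `𝒟(A)`. -/
theorem res_simple_torsion_supp [IsSimpleModule (BRing K) N] (h : IsTinvDTorsion K N) :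
    IsSimpleModule (DA K m) (Res m N) ∧ IsDTorsion K m (Res m N) ∧
      ∃ p, p ∉ orbit (hIdeal K) ∧ supp K m (Res m N) = orbit p := by
  have : Nontrivial (Res m N) := IsSimpleModule.nontrivial (BRing K) N
  obtain ⟨p, hp⟩ := (isDTorsion_res (m := m) h).exists_mem_supp
  obtain ⟨v, hv, h0⟩ := mem_supp_iff.1 hp
  have hp' := notMem_orbit_hIdeal_of_mem_supp_res hp
  obtain ⟨h1, h2, h3⟩ := isSimpleModule_res hp' hv h0
    (IsSimpleModule.toSpanSingleton_surjective (BRing K) (M := N) h0)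
  exact ⟨h1, h2, p, hp', h3⟩

/-- All weights of `A` and `A'` lie in the orbit of `(h)`. -/
theorem isEmpty_of_supp_eq_orbit {M : Type*} [AddCommGroup M] [Module (DA K m) M]
    {p : MaximalSpectrum K[X]} (hp : p ∉ orbit (hIdeal K)) (hM : supp K m M = orbit p) :
    IsEmpty (M ≃ₗ[DA K m] cusp K m) ∧ IsEmpty (M ≃ₗ[DA K m] ComplMod K m) := by
  have hmem : p ∈ supp K m M := hM ▸ self_mem_orbit p
  constructor
  · refine ⟨fun f => hp ?_⟩
    have h := supp_subset_of_equiv f hmem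
    rw [(cusp_simple_torsion_supp K m).2.2] at h
    obtain ⟨j, -, rfl⟩ := h
    exact mem_orbit_iff.2 ⟨j, rfl⟩
  · refine ⟨fun f => hp ?_⟩
    have h := supp_subset_of_equiv f hmem
    rw [(complMod_simple_torsion_supp K m).2.2] at h
    obtain ⟨j, -, rfl⟩ := h
    exact mem_orbit_iff.2 ⟨j, rfl⟩

/-- This shows `𝔹/𝔹𝔭 ≠ 0`. With `f` a generator of `𝔭`, an equation `b f = 1` gives `b₀ f = 1` in
`T⁻¹D` on comparing coefficients of `x⁰`. Clearing the denominator places an element of `T` in `𝔭`,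
which is impossible off the orbit of `(h)`. -/
theorem one_notMem_span_dToB {p : MaximalSpectrum K[X]} (hp : p ∉ orbit (hIdeal K)) :
    (1 : BRing K) ∉ Submodule.span (BRing K) (dToB K '' p.asIdeal) := by
  obtain ⟨f, -, hf⟩ := exists_irreducible_span p
  intro h
  have hle : Submodule.span (BRing K) (dToB K '' p.asIdeal) ≤
      Submodule.span (BRing K) {dToB K f} := by
    rw [Submodule.span_le]
    rintro _ ⟨d, hd, rfl⟩
    rw [SetLike.mem_coe, hf, Ideal.mem_span_singleton] at hd
    obtain ⟨c, rfl⟩ := hd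
    rw [mul_comm, map_mul]
    exact Submodule.smul_mem _ _ (Submodule.mem_span_singleton_self _)
  obtain ⟨b, hb⟩ := Submodule.mem_span_singleton.1 (hle h)
  have h1 := congrArg (fun b : BRing K => b.coeff (xp (sigmaT K) 0)) hb
  have h2 : (1 : BRing K).coeff (xp (sigmaT K) 0) = 1 :=
    (SkewLaurent.coeff_mono (sigmaT K) 0 0 1).trans (if_pos rfl)
  simp only [h2, smul_eq_mul] at h1
  have h3 := SkewLaurent.coeff_mul_const b (algebraMap K[X] (TinvD K) f)
  have h4 : b.coeff (xp (sigmaT K) 0) * algebraMap K[X] (TinvD K) f = 1 := h3.symm.trans h1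
  obtain ⟨a, t, hat⟩ := IsLocalization.exists_mk'_eq (shiftMonoid K) (b.coeff (xp (sigmaT K) 0))
  rw [← hat] at h4
  have h5 : algebraMap K[X] (TinvD K) (a * f) = algebraMap K[X] (TinvD K) t := by
    rw [map_mul, ← IsLocalization.mk'_spec' (TinvD K) a t, mul_assoc, h4, mul_one]
  have h6 := IsLocalization.injective (TinvD K) shiftMonoid_le_nonZeroDivisors h5
  refine notMem_of_mem_shiftMonoid hp t.2 ?_
  rw [← h6, hf]
  exact Ideal.mul_mem_left _ _ (Ideal.mem_span_singleton_self f)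

theorem bQuot_simple_torsion_supp {p : MaximalSpectrum K[X]} (hp : p ∉ orbit (hIdeal K)) :
    IsSimpleModule (DA K m) (Res m (BQuot K p)) ∧ IsDTorsion K m (Res m (BQuot K p)) ∧
      supp K m (Res m (BQuot K p)) = orbit p := by
  set P : Submodule (BRing K) (BRing K) := Submodule.span (BRing K) (dToB K '' p.asIdeal) with hP
  refine isSimpleModule_res (N := BQuot K p) (v := P.mkQ 1) hp ?_ ?_ ?_
  · intro d hd
    refine (dToDA_smul_res (m := m) (N := BQuot K p) d _).trans ?_
    have h : const (sigmaT K) (algebraMap K[X] (TinvD K) d) • P.mkQ 1 = 0 := by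
      rw [← LinearMap.map_smul, smul_eq_mul, mul_one, Submodule.mkQ_apply,
        Submodule.Quotient.mk_eq_zero]
      exact Submodule.subset_span ⟨d, hd, rfl⟩
    exact h
  · exact fun h => one_notMem_span_dToB hp ((Submodule.Quotient.mk_eq_zero P).1 h)
  · intro u
    obtain ⟨b, rfl⟩ := P.mkQ_surjective u
    refine ⟨b, ?_⟩
    have h : b • P.mkQ 1 = P.mkQ b := by rw [← LinearMap.map_smul, smul_eq_mul, mul_one]
    exact h

end BModules

/-! ### Classification and its consequences for supports. -/

section Classification

variable {K : Type*} [Field K]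

theorem OtherOrbit.eq_orbit_of_mem (O : OtherOrbit K) {p : MaximalSpectrum K[X]} (hp : p ∈ O.1) :
    O.1 = orbit p := by
  obtain ⟨q, hq⟩ := O.2.1
  rw [hq] at hp ⊢
  exact (orbit_eq_of_mem hp).symm

theorem OtherOrbit.notMem_orbit_hIdeal (O : OtherOrbit K) {p : MaximalSpectrum K[X]}
    (hp : p ∈ O.1) : p ∉ orbit (hIdeal K) := fun h =>
  O.2.2 ((O.eq_orbit_of_mem hp).trans (orbit_eq_of_mem h))

variable [CharZero K] {m : ℕ} {M : Type*} [AddCommGroup M] [Module (DA K m) M]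

theorem orbit_infinite (p : MaximalSpectrum K[X]) : (orbit p).Infinite := by
  refine (Set.infinite_range_of_injective (shift_injective p)).mono ?_
  rintro _ ⟨n, rfl⟩
  exact mem_orbit_iff.2 ⟨n, rfl⟩

/-- The classification of the simple `D`-torsion `𝒟(A)`-modules. -/
theorem equiv_cusp_or_complMod_or_bQuot (rep : OtherOrbit K → MaximalSpectrum K[X])
    (hrep : ∀ O, rep O ∈ O.1) [IsSimpleModule (DA K m) M] (hM : IsDTorsion K m M) :
    Nonempty (M ≃ₗ[DA K m] cusp K m) ∨ Nonempty (M ≃ₗ[DA K m] ComplMod K m) ∨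
      ∃ O : OtherOrbit K, Nonempty (M ≃ₗ[DA K m] Res m (BQuot K (rep O))) := by
  have := IsSimpleModule.nontrivial (DA K m) M
  obtain ⟨p, hp⟩ := hM.exists_mem_supp
  by_cases h : p ∈ orbit (hIdeal K)
  · exact (equiv_cusp_or_complMod hp h).imp_right Or.inl
  · let O : OtherOrbit K := ⟨orbit p, ⟨p, rfl⟩, fun h' => h (h' ▸ self_mem_orbit p)⟩
    have hO : p ∈ O.1 := self_mem_orbit p
    obtain ⟨h1, -, h3⟩ := bQuot_simple_torsion_supp (m := m) (O.notMem_orbit_hIdeal (hrep O))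
    refine Or.inr (Or.inr ⟨O, nonempty_equiv_of_mem_supp hp ?_⟩)
    rwa [h3, ← O.eq_orbit_of_mem (hrep O)]

theorem supp_infinite [IsSimpleModule (DA K m) M] (hM : IsDTorsion K m M) :
    (supp K m M).Infinite := by
  have hne : ∀ O : OtherOrbit K, ∃ p, p ∈ O.1 := fun O => by
    obtain ⟨p, hp⟩ := O.2.1
    exact ⟨p, hp ▸ self_mem_orbit p⟩
  choose rep hrep using hne
  rcases equiv_cusp_or_complMod_or_bQuot rep hrep hM with ⟨⟨f⟩⟩ | ⟨⟨f⟩⟩ | ⟨O, ⟨f⟩⟩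
  · exact supp_eq_of_equiv f ▸ supp_cusp_infinite K m
  · exact supp_eq_of_equiv f ▸ supp_complMod_infinite K m
  · rw [supp_eq_of_equiv f,
      (bQuot_simple_torsion_supp (O.notMem_orbit_hIdeal (hrep O))).2.2]
    exact orbit_infinite _

theorem nonempty_equiv_of_res_equiv {N N' : Type*} [AddCommGroup N] [Module (BRing K) N]
    [AddCommGroup N'] [Module (BRing K) N'] (f : Res m N ≃ₗ[DA K m] Res m N') :
    Nonempty (N ≃ₗ[BRing K] N') :=
  ⟨{ toFun := f
     invFun := f.symm
     left_inv := f.left_inv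
     right_inv := f.right_inv
     map_add' := f.map_add
     map_smul' := map_BRing_smul f.toLinearMap }⟩

end Classification

end CuspD

end

theorem theorem3p5 (K : Type u) [Field K] [CharZero K] (m : ℕ)
    (rep : OtherOrbit K → MaximalSpectrum K[X]) (hrep : ∀ O, rep O ∈ O.1) :
    -- for simple modules, `D`-torsion is the same as weight
    (∀ (M : Type v) [AddCommGroup M] [Module (DA K m) M], IsSimpleModule (DA K m) M →
      (IsDTorsion K m M ↔ IsWeight K m M)) ∧
    -- `A` and `A'` are non-isomorphic simple `D`-torsion modules
    (IsSimpleModule (DA K m) (cusp K m) ∧ IsDTorsion K m (cusp K m)) ∧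
    (IsSimpleModule (DA K m) (ComplMod K m) ∧ IsDTorsion K m (ComplMod K m)) ∧
    IsEmpty (cusp K m ≃ₗ[DA K m] ComplMod K m) ∧
    -- restriction sends simple `T⁻¹D`-torsion `𝔹`-modules to simple `D`-torsion modules
    -- isomorphic neither to `A` nor to `A'`
    (∀ (N : Type v) [AddCommGroup N] [Module (BRing K) N],
      IsSimpleModule (BRing K) N → IsTinvDTorsion K N →
      IsSimpleModule (DA K m) (Res m N) ∧ IsDTorsion K m (Res m N) ∧
      IsEmpty (Res m N ≃ₗ[DA K m] cusp K m) ∧ IsEmpty (Res m N ≃ₗ[DA K m] ComplMod K m)) ∧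
    -- restriction is injective on isomorphism classes
    (∀ (N : Type v) (N' : Type w) [AddCommGroup N] [Module (BRing K) N]
      [AddCommGroup N'] [Module (BRing K) N'],
      IsSimpleModule (BRing K) N → IsTinvDTorsion K N →
      IsSimpleModule (BRing K) N' → IsTinvDTorsion K N' →
      Nonempty (Res m N ≃ₗ[DA K m] Res m N') → Nonempty (N ≃ₗ[BRing K] N')) ∧
    -- every simple `D`-torsion module is `A`, `A'` or such a restriction
    (∀ (M : Type v) [AddCommGroup M] [Module (DA K m) M],
      IsSimpleModule (DA K m) M → IsDTorsion K m M →
      Nonempty (M ≃ₗ[DA K m] cusp K m) ∨ Nonempty (M ≃ₗ[DA K m] ComplMod K m) ∨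
      ∃ (N : Type u) (_ : AddCommGroup N) (_ : Module (BRing K) N),
        IsSimpleModule (BRing K) N ∧ IsTinvDTorsion K N ∧ Nonempty (M ≃ₗ[DA K m] Res m N)) ∧
    -- the modules `𝔹/𝔹𝔭_O` are simple, `D`-torsion, with support `O`, and are isomorphic
    -- neither to `A` nor to `A'`
    (∀ O : OtherOrbit K,
      IsSimpleModule (DA K m) (Res m (BQuot K (rep O))) ∧
      IsDTorsion K m (Res m (BQuot K (rep O))) ∧
      supp K m (Res m (BQuot K (rep O))) = O.1 ∧
      IsEmpty (Res m (BQuot K (rep O)) ≃ₗ[DA K m] cusp K m) ∧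
      IsEmpty (Res m (BQuot K (rep O)) ≃ₗ[DA K m] ComplMod K m)) ∧
    -- they are non-isomorphic for distinct orbits
    (∀ O O' : OtherOrbit K,
      Nonempty (Res m (BQuot K (rep O)) ≃ₗ[DA K m] Res m (BQuot K (rep O'))) → O = O') ∧
    -- every simple `D`-torsion module is `A`, `A'` or one of the modules `𝔹/𝔹𝔭_O`
    (∀ (M : Type v) [AddCommGroup M] [Module (DA K m) M],
      IsSimpleModule (DA K m) M → IsDTorsion K m M →
      Nonempty (M ≃ₗ[DA K m] cusp K m) ∨ Nonempty (M ≃ₗ[DA K m] ComplMod K m) ∨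
      ∃ O : OtherOrbit K, Nonempty (M ≃ₗ[DA K m] Res m (BQuot K (rep O)))) ∧
    -- every simple `D`-torsion module has infinite support and infinite dimension
    (∀ (M : Type v) [AddCommGroup M] [Module (DA K m) M] [Module K M]
      [IsScalarTower K (DA K m) M],
      IsSimpleModule (DA K m) M → IsDTorsion K m M →
      (supp K m M).Infinite ∧ ¬ FiniteDimensional K M) := by
  have hB : ∀ O : OtherOrbit K, _ := fun O =>
    bQuot_simple_torsion_supp (m := m) (O.notMem_orbit_hIdeal (hrep O))
  have hsupp : ∀ O : OtherOrbit K, supp K m (Res m (BQuot K (rep O))) = O.1 := fun O => by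
    rw [(hB O).2.2, O.eq_orbit_of_mem (hrep O)]
  obtain ⟨hA, hA', -⟩ := cusp_simple_torsion_supp K m
  obtain ⟨hC, hC', -⟩ := complMod_simple_torsion_supp K m
  refine ⟨fun M _ _ hM => ⟨IsDTorsion.isWeight, IsWeight.isDTorsion⟩, ⟨hA, hA'⟩, ⟨hC, hC'⟩,
    isEmpty_cusp_equiv_complMod K m, ?_, ?_, ?_, ?_, ?_, ?_, ?_⟩
  · intro N _ _ hN ht
    obtain ⟨h1, h2, p, hp, h3⟩ := res_simple_torsion_supp (m := m) ht
    obtain ⟨h4, h5⟩ := isEmpty_of_supp_eq_orbit hp h3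
    exact ⟨h1, h2, h4, h5⟩
  · rintro N N' _ _ _ _ - - - - ⟨f⟩
    exact nonempty_equiv_of_res_equiv f
  · intro M _ _ hM ht
    refine (equiv_cusp_or_complMod_or_bQuot rep hrep ht).imp_right (Or.imp_right ?_)
    rintro ⟨O, hO⟩
    -- The required `𝔹`-module is `𝔹/𝔹𝔭` itself; its simplicity and torsion over `𝔹` are inherited
    -- from those over the subring `𝒟(A)`.
    exact ⟨BQuot K (rep O), inferInstance, inferInstance, isSimpleModule_of_res (hB O).1,
      isTinvDTorsion_of_res (hB O).2.1, hO⟩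
  · intro O
    obtain ⟨h4, h5⟩ := isEmpty_of_supp_eq_orbit (O.notMem_orbit_hIdeal (hrep O)) (hB O).2.2
    exact ⟨(hB O).1, (hB O).2.1, hsupp O, h4, h5⟩
  · rintro O O' ⟨f⟩
    exact Subtype.ext (by rw [← hsupp O, ← hsupp O', supp_eq_of_equiv f])
  · intro M _ _ hM ht
    exact equiv_cusp_or_complMod_or_bQuot rep hrep ht
  · intro M _ _ _ _ hM ht
    exact ⟨supp_infinite ht, not_finiteDimensional_of_infinite_supp (supp_infinite ht)⟩
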